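/- Let $n\ge 2$, let $F_n=\langle a_1,\dots,a_n\rangle$ be the free group of rank $n$, and let $\mathcal R=\mathcal P=\{(r_1,\dots,r_n): r_i>0 \text{ for all } i,\ r_1+\cdots+r_n=1/2\}$. For ${\bf r}\in\mathcal R$ let $d_{\bf r}$ be the path metric on the Cayley graph $\mathrm{Cay}(F_n)$ (edges join $x$ to $xa_i^{\pm1}$) for which the edges labelled $a_i^{\pm1}$ have length $-\log r_i$. For a subgroup $G\subset F_n$ let $$\delta_G({\bf r})=\limsup_{R\to\infty}\frac{\log\#\{g\in G: d_{\bf r}(\mathrm{id},g)\le R\}}{R},\qquad \delta({\bf r}):=\delta_{F_n}({\bf r}).$$ For ${\bf p}\in\mathcal P$, the weighted Laplacian $\Delta_{\bf p}=I-A_{\bf p}$ acts on $L^2(G\backslash \mathrm{Cay}(F_n))$, the space of square-summable functions on the set of cosets $Gx$, $x\in F_n$, where $(A_{\bf p}f)(x)=\sum_{i=1}^n p_i\,(f(xa_i)+f(xa_i^{-1}))$; the bottom of its spectrum is denoted by $\lambda_0^G({\bf p})$. For ${\bf r}\in\mathcal R$ and $s>0$ put $H({\bf r},s)=(r_1^s,\dots,r_n^s)\in(0,1)^n$.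 For ${\bf u}\in(0,1)^n$ let $w_k=u_k^{-1}-u_k$ and $D({\bf u})=\sum_j\prod_{k\ne j}w_k$, and define ${\bf p}({\bf u})\in\mathcal P$ and $\lambda({\bf u})\in\mathbb R$ by $$p_i({\bf u})=\frac{\prod_{k\neq i}w_k}{2D({\bf u})},\qquad \lambda({\bf u})=\frac{1}{D({\bf u})}\Bigl(\sum_j(1-u_j)\prod_{k\ne j}w_k-\frac12\prod_{k}w_k\Bigr);$$ equivalently, $({\bf p},\lambda)=({\bf p}({\bf u}),\lambda({\bf u}))$ is the unique solution of $\lambda=1-2\sum_k u_kp_k-(u_i^{-1}-u_i)p_i$ $(i=1,\dots,n)$ with $p_1+\cdots+p_n=1/2$. Let ${\bf p}_*({\bf r},s)={\bf p}(H({\bf r},s))$ if $s>\delta({\bf r})/2$, and ${\bf p}_*({\bf r},s)={\bf p}(H({\bf r},\delta({\bf r})/2))$ if $s\le\delta({\bf r})/2$. Theorem. For every subgroup $G\subset F_n$ and every ${\bf r}\in\mathcal R$, $$\lambda_0^G\bigl({\bf p}_*({\bf r},\delta_G({\bf r}))\bigr)=\begin{cases}\lambda\circ H({\bf r},\delta_G({\bf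 r})) & \text{if } \delta_G({\bf r})>\delta({\bf r})/2,\\ \lambda\circ H({\bf r},\delta({\bf r})/2) & \text{if } \delta_G({\bf r})\le\delta({\bf r})/2.\end{cases}$$ -/

import Mathlib

open scoped ENNReal

noncomputable section

namespace WeightedCogrowth

/-- The parameter simplex: positive `n`-tuples with sum `1 / 2`. It is the range both of the
edge-length parameters `r` and of the weights `p`. -/
def paramSet (n : ℕ) : Set (Fin n → ℝ) :=
  {r | (∀ i, 0 < r i) ∧ ∑ i, r i = 1 / 2}

/-! ### The weighted Cayley graph of the free group and the Poincaré exponent -/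

/-- The length of the edge path in the Cayley graph whose consecutive edges carry the labels
`w` (the letter `(i, true)` is `a_i`, the letter `(i, false)` is `a_i⁻¹`), when the edges
labelled `a_i` or `a_i⁻¹` have length `-log (r i)`. -/
def pathLength {n : ℕ} (r : Fin n → ℝ) (w : List (Fin n × Bool)) : ℝ :=
  (w.map fun a => -Real.log (r a.1)).sum

/-- The path metric on the vertices of the Cayley graph of the free group: the infimum of the
lengths of the edge paths from `x` to `y`. The path starting at `x` with labels `w` ends at
`x * FreeGroup.mk w`. -/
def pathDist {n : ℕ} (r : Fin n → ℝ) (x y : FreeGroup (Fin n)) : ℝ :=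
  sInf (pathLength r '' {w : List (Fin n × Bool) | x * FreeGroup.mk w = y})

/-- The Poincaré exponent of a subgroup `G` of the free group. -/
def poincareExponent {n : ℕ} (G : Subgroup (FreeGroup (Fin n))) (r : Fin n → ℝ) : ℝ :=
  Filter.limsup
    (fun R : ℝ => Real.log ({g : FreeGroup (Fin n) | g ∈ G ∧ pathDist r 1 g ≤ R}.ncard : ℝ) / R)
    Filter.atTop

/-! ### The correspondence between edge lengths and weights -/

/-- The change of variables `(r, s) ↦ u`, `u_i = r_i ^ s`. -/
def H {n : ℕ} (r : Fin n → ℝ) (s : ℝ) : Fin n → ℝ := fun i => r i ^ s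

/-- The coefficient `c_i(u, p) = 1 - 2 ∑ₖ uₖ pₖ - (u_i⁻¹ - u_i) p_i`. -/
def coeff {n : ℕ} (u p : Fin n → ℝ) (i : Fin n) : ℝ :=
  1 - 2 * ∑ k, u k * p k - ((u i)⁻¹ - u i) * p i

/-- The determinant `D(u) = ∑ⱼ ∏_{k ≠ j} (uₖ⁻¹ - uₖ)`. -/
def detD {n : ℕ} (u : Fin n → ℝ) : ℝ :=
  ∑ j, ∏ k ∈ Finset.univ.erase j, ((u k)⁻¹ - u k)

/-- The weight `p(u)`. -/
def weightOf {n : ℕ} (u : Fin n → ℝ) : Fin n → ℝ := fun i =>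
  (∏ k ∈ Finset.univ.erase i, ((u k)⁻¹ - u k)) / (2 * detD u)

/-- The number `λ(u)`. -/
def eigenvalueOf {n : ℕ} (u : Fin n → ℝ) : ℝ :=
  (detD u)⁻¹ * (∑ j, (1 - u j) * ∏ k ∈ Finset.univ.erase j, ((u k)⁻¹ - u k)
    - (1 / 2) * ∏ l, ((u l)⁻¹ - u l))

/-- For `u ∈ (0,1)^n` the pair `(p(u), λ(u))` is the unique solution `(p, t)` of the linear system
`c_1(u, p) = ⋯ = c_n(u, p) = t`, `p_1 + ⋯ + p_n = 1 / 2`, and `p(u)` is a weight. -/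
theorem weightOf_spec {n : ℕ} (hn : 1 ≤ n) (u : Fin n → ℝ) (hu : ∀ i, 0 < u i ∧ u i < 1) :
    weightOf u ∈ paramSet n ∧ ∀ (p : Fin n → ℝ) (t : ℝ),
      ((∀ i, coeff u p i = t) ∧ ∑ i, p i = 1 / 2) ↔ p = weightOf u ∧ t = eigenvalueOf u := by
  obtain ⟨w, hwdef⟩ : ∃ w : Fin n → ℝ, w = fun k => (u k)⁻¹ - u k := ⟨_, rfl⟩
  have hw : ∀ k, (u k)⁻¹ - u k = w k := fun k => by rw [hwdef]
  have hpos : ∀ k, 0 < w k := fun k => by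
    rw [← hw k]
    exact sub_pos.mpr ((hu k).2.trans (one_lt_inv₀ (hu k).1 |>.mpr (hu k).2))
  have : Nonempty (Fin n) := ⟨⟨0, hn⟩⟩
  obtain ⟨P, hPdef⟩ : ∃ P : ℝ, ∏ k, w k = P := ⟨_, rfl⟩
  obtain ⟨S, hSdef⟩ : ∃ S : ℝ, ∑ k, (w k)⁻¹ = S := ⟨_, rfl⟩
  have hP : 0 < P := hPdef ▸ Finset.prod_pos fun k _ => hpos k
  have hS : 0 < S :=
    hSdef ▸ Finset.sum_pos (fun k _ => inv_pos.mpr (hpos k)) Finset.univ_nonempty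
  have he : ∀ j, ∏ k ∈ Finset.univ.erase j, w k = P * (w j)⁻¹ := fun j => by
    rw [← hPdef, ← Finset.prod_erase_mul _ _ (Finset.mem_univ j), mul_assoc,
      mul_inv_cancel₀ (hpos j).ne', mul_one]
  have hD : detD u = P * S := by
    simp only [detD, hw, he, ← Finset.mul_sum, hSdef]
  have hp : ∀ i, weightOf u i = (w i)⁻¹ / (2 * S) := fun i => by
    simp only [weightOf, hw, he, hD]
    field_simp
  have hsum : ∑ i, weightOf u i = 1 / 2 := by
    simp only [hp, ← Finset.sum_div, hSdef]
    field_simp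
  have hl : eigenvalueOf u = (∑ j, (1 - u j) * (w j)⁻¹ - 1 / 2) / S := by
    have h1 : ∑ j, (1 - u j) * (P * (w j)⁻¹) =
        P * ∑ j, (1 - u j) * (w j)⁻¹ := by
      rw [Finset.mul_sum]
      exact Finset.sum_congr rfl fun j _ => by ring
    simp only [eigenvalueOf, hw, he, hD, hPdef, h1]
    field_simp
  have hc : ∀ i, coeff u (weightOf u) i = eigenvalueOf u := fun i => by
    have h1 : ∑ k, u k * ((w k)⁻¹ / (2 * S)) =
        (∑ k, u k * (w k)⁻¹) / (2 * S) := by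
      rw [Finset.sum_div]
      exact Finset.sum_congr rfl fun j _ => by ring
    have h2 := (hpos i).ne'
    simp only [coeff, hl, hp, hw, h1, sub_mul, one_mul, Finset.sum_sub_distrib, hSdef]
    field_simp
  refine ⟨⟨fun i => ?_, hsum⟩, fun p t => ⟨fun ⟨h, hs⟩ => ?_, fun ⟨h, ht⟩ => ?_⟩⟩
  · rw [hp]
    exact div_pos (inv_pos.mpr (hpos i)) (by linarith)
  · obtain ⟨τ, hτ⟩ : ∃ τ : ℝ, τ = 1 - 2 * ∑ k, u k * p k - t := ⟨_, rfl⟩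
    have h1 : ∀ i, p i = τ * (w i)⁻¹ := fun i => by
      have := h i
      simp only [coeff, hw] at this
      have h2 := (hpos i).ne'
      field_simp
      linarith
    have h3 : τ * S = 1 / 2 := by
      rw [← hSdef, Finset.mul_sum, ← hs]
      exact Finset.sum_congr rfl fun i _ => (h1 i).symm
    have h4 : p = weightOf u := by
      funext i
      have h5 : τ = 1 / 2 / S := by rw [← h3]; field_simp
      rw [h1, hp, h5]
      field_simp
    exact ⟨h4, by rw [← h ⟨0, hn⟩, h4, hc]⟩
  · rw [h, ht]
    exact ⟨hc, hsum⟩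

open Classical in
/-- The weight `p_*(r, s)`, equal to `p(H(r, s))` if `s > δ(r) / 2` and to `p(H(r, δ(r) / 2))`
otherwise, where `δ(r)` is the Poincaré exponent of the whole free group. -/
def pStar {n : ℕ} (r : Fin n → ℝ) (s : ℝ) : Fin n → ℝ :=
  if poincareExponent (⊤ : Subgroup (FreeGroup (Fin n))) r / 2 < s then weightOf (H r s)
  else weightOf (H r (poincareExponent (⊤ : Subgroup (FreeGroup (Fin n))) r / 2))

/-! ### The weighted Laplacian on the quotient graph -/

/-- The vertex set of the quotient graph `G \ Cay(F_n)`: the cosets `G x`. -/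
abbrev Vertex {n : ℕ} (G : Subgroup (FreeGroup (Fin n))) : Type :=
  Quotient (QuotientGroup.rightRel G)

/-- The permutation `G x ↦ G x g` of the vertex set. -/
def rightMul {n : ℕ} (G : Subgroup (FreeGroup (Fin n))) (g : FreeGroup (Fin n)) :
    Vertex G ≃ Vertex G where
  toFun := Quotient.map (fun x => x * g) fun x y h => by
    change QuotientGroup.rightRel G x y at h
    change QuotientGroup.rightRel G (x * g) (y * g)
    rw [QuotientGroup.rightRel_apply] at h ⊢
    simpa [mul_assoc] using h
  invFun := Quotient.map (fun x => x * g⁻¹) fun x y h => by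
    change QuotientGroup.rightRel G x y at h
    change QuotientGroup.rightRel G (x * g⁻¹) (y * g⁻¹)
    rw [QuotientGroup.rightRel_apply] at h ⊢
    simpa [mul_assoc] using h
  left_inv := by
    rintro ⟨x⟩
    change (Quotient.mk _ (x * g * g⁻¹) : Vertex G) = Quotient.mk _ x
    rw [mul_inv_cancel_right]
  right_inv := by
    rintro ⟨x⟩
    change (Quotient.mk _ (x * g⁻¹ * g) : Vertex G) = Quotient.mk _ x
    rw [inv_mul_cancel_right]

/-- The complex Hilbert space `L²(G \ Cay(F_n))`. -/
abbrev L2 {n : ℕ} (G : Subgroup (FreeGroup (Fin n))) : Type :=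
  lp (fun _ : Vertex G => ℂ) 2

theorem memLp_comp {V : Type} (σ : V ≃ V) (f : lp (fun _ : V => ℂ) 2) :
    Memℓp (fun x => (f (σ x) : ℂ)) 2 := by
  have h : 0 < (2 : ℝ≥0∞).toReal := by norm_num
  rw [memℓp_gen_iff h]
  exact σ.summable_iff.mpr ((lp.memℓp f).summable h)

/-- Composition with a permutation `σ` of `V`, as an operator on `L²(V)`. -/
def compPerm {V : Type} (σ : V ≃ V) :
    lp (fun _ : V => ℂ) 2 →L[ℂ] lp (fun _ : V => ℂ) 2 :=
  LinearMap.mkContinuous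
    { toFun := fun f => ⟨fun x => f (σ x), memLp_comp σ f⟩
      map_add' := fun _ _ => rfl
      map_smul' := fun _ _ => rfl } 1 fun f => by
    have h : 0 < (2 : ℝ≥0∞).toReal := by norm_num
    rw [one_mul, lp.norm_eq_tsum_rpow h, lp.norm_eq_tsum_rpow h]
    exact le_of_eq (congrArg (· ^ (1 / (2 : ℝ≥0∞).toReal))
      (σ.tsum_eq fun x => ‖f x‖ ^ (2 : ℝ≥0∞).toReal))

/-- The transition operator `(A_p f)(x) = ∑ i, p_i (f (x a_i) + f (x a_i⁻¹))`. -/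
def transition {n : ℕ} (G : Subgroup (FreeGroup (Fin n))) (p : Fin n → ℝ) :
    L2 G →L[ℂ] L2 G :=
  ∑ i, (p i : ℂ) • (compPerm (rightMul G (FreeGroup.of i)) +
    compPerm (rightMul G (FreeGroup.of i)⁻¹))

/-- The weighted Laplacian `Δ_p = I - A_p` on `L²(G \ Cay(F_n))`. -/
def laplacian {n : ℕ} (G : Subgroup (FreeGroup (Fin n))) (p : Fin n → ℝ) :
    L2 G →L[ℂ] L2 G :=
  1 - transition G p

theorem transition_apply {n : ℕ} (G : Subgroup (FreeGroup (Fin n))) (p : Fin n → ℝ) (f : L2 G)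
    (x : Vertex G) :
    transition G p f x = ∑ i, (p i : ℂ) * (f (rightMul G (FreeGroup.of i) x) +
      f (rightMul G (FreeGroup.of i)⁻¹ x)) := by
  simp only [transition, sum_apply, lp.coeFn_sum, Finset.sum_apply]
  rfl

/-- `m` is the bottom of the spectrum of the bounded operator `T`: the least element of its
spectrum (which consists of real numbers when `T` is symmetric). -/
def IsBottomOfSpectrum {E : Type*} [NormedAddCommGroup E] [InnerProductSpace ℂ E]
    (T : E →L[ℂ] E) (m : ℝ) : Prop :=
  IsLeast {t : ℝ | (t : ℂ) ∈ spectrum ℂ T} m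

end WeightedCogrowth

end

noncomputable section

namespace WeightedCogrowth

/-! Put `u = H r s`, `p = weightOf u`, `λ = eigenvalueOf u`, and `w(x) = ∏ u` over the letters of
the reduced word of `x`, so that `w(x) = exp(-s d(1, x))`. The linear system defining `(p, λ)` says
exactly that `A_p w = (1 - λ) w - c δ₁` on the free group, with `c > 0`
(`sum_weightOf_mul_wordWeight`): `w` is a Green function at the value `1 - λ`. Summing it over the
fibres of `F_n → G \ Cay(F_n)` gives a Green function on the quotient whose value at the trivial
coset is the Poincaré series of `G` at `s`.

If that series converges, the fibre sum is a positive finite supersolution, and Schur's test gives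
`‖A_p‖ ≤ 1 - λ` on the quotient. Conversely, suppose `‖A_p‖ < 1 - λ` and the Poincaré series of
`F_n` converges at `2s`. The latter means `w ∈ ℓ²(F_n)`. The norm bound lifts to the covering `F_n`,
so `w` is the sum of its Neumann series; the pushed-down Neumann series converges, hence so does the
Poincaré series of `G`.

Both quantities depend continuously on `s`. If `δ_G > δ/2`, a strict inequality at `s = δ_G` would
persist for smaller `s`, contradicting the definition of `δ_G`. If `δ_G ≤ δ/2`, a strict inequality
at `s = δ/2` would bound the `ℓ²` norm of `w` uniformly as `s ↓ δ/2`, making the series of `F_n`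
converge at `δ`. It diverges there, because convergence is equivalent to the open condition `λ < 0`.
Thus `‖A_p‖ = 1 - λ` in both cases. Since `A_p` is self-adjoint with nonnegative weights, its norm
lies in its spectrum, and the bottom of the spectrum of `1 - A_p` is `1 - ‖A_p‖ = λ`.

Green functions, norms and series are handled in `ℝ≥0∞`, where sums may be interchanged without
summability conditions. -/

/-! ### Weighted sums over signed letters -/

section LetterSum

variable {ι V W : Type*} [Fintype ι]

/-- The weighted sum of `f` over the neighbours of `v`, where the neighbour of `v` along the
letter `a` is `τ a v`. -/
def letterSum (τ : ι × Bool → Equiv.Perm V) (q : ι → ℝ≥0∞) (f : V → ℝ≥0∞) (v : V) : ℝ≥0∞ :=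
  ∑ a : ι × Bool, q a.1 * f (τ a v)

/-- The permutations attached to opposite letters are inverse to each other. -/
def IsInverseClosed (τ : ι × Bool → Equiv.Perm V) : Prop :=
  ∀ a, τ (a.1, !a.2) = (τ a).symm

/-- `M` bounds the norm of `letterSum τ q` on square-summable functions. -/
def L2Bound (τ : ι × Bool → Equiv.Perm V) (q : ι → ℝ≥0∞) (M : ℝ≥0∞) : Prop :=
  ∀ f : V → ℝ≥0∞, ∑' v, letterSum τ q f v ^ 2 ≤ M ^ 2 * ∑' v, f v ^ 2

variable {τ : ι × Bool → Equiv.Perm V} {q : ι → ℝ≥0∞}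

theorem letterSum_add (f g : V → ℝ≥0∞) :
    letterSum τ q (fun v => f v + g v) = fun v => letterSum τ q f v + letterSum τ q g v := by
  funext v
  simp only [letterSum, mul_add, Finset.sum_add_distrib]

theorem letterSum_const_mul (c : ℝ≥0∞) (f : V → ℝ≥0∞) :
    letterSum τ q (fun v => c * f v) = fun v => c * letterSum τ q f v := by
  funext v
  simp only [letterSum, Finset.mul_sum]
  exact Finset.sum_congr rfl fun _ _ => by ring

theorem letterSum_tsum {κ : Type*} (f : κ → V → ℝ≥0∞) :
    letterSum τ q (fun v => ∑' k, f k v) = fun v => ∑' k, letterSum τ q (f k) v := by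
  funext v
  simp only [letterSum, ← ENNReal.tsum_mul_left]
  exact (Summable.tsum_finsetSum fun _ _ => ENNReal.summable).symm

theorem tsum_letterSum (f : V → ℝ≥0∞) :
    ∑' v, letterSum τ q f v = (∑ a : ι × Bool, q a.1) * ∑' v, f v := by
  simp only [letterSum]
  rw [Summable.tsum_finsetSum fun _ _ => ENNReal.summable, Finset.sum_mul]
  exact Finset.sum_congr rfl fun a _ => by rw [ENNReal.tsum_mul_left, (τ a).tsum_eq]

/-- Symmetry of the operator: substituting `v ↦ τ a v` moves the letter `a` to the other factor as
its inverse, and both carry the same weight. -/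
theorem tsum_mul_letterSum (hτ : IsInverseClosed τ) (f g : V → ℝ≥0∞) :
    ∑' v, g v * letterSum τ q f v = ∑' v, letterSum τ q g v * f v := by
  have e : ∀ a : ι × Bool, ∑' v, g v * (q a.1 * f (τ a v)) =
      ∑' v, q a.1 * g (τ (a.1, !a.2) v) * f v := fun a => by
    rw [← (τ a).tsum_eq fun v => q a.1 * g (τ (a.1, !a.2) v) * f v]
    exact tsum_congr fun v => by rw [hτ, Equiv.symm_apply_apply]; ring
  simp only [letterSum, Finset.mul_sum, Finset.sum_mul]
  rw [Summable.tsum_finsetSum fun _ _ => ENNReal.summable,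
    Summable.tsum_finsetSum fun _ _ => ENNReal.summable]
  simp only [e]
  let b : ι × Bool ≃ ι × Bool := Equiv.prodCongr (Equiv.refl ι) Equiv.boolNot
  exact b.sum_comp fun a : ι × Bool => ∑' v, q a.1 * g (τ a v) * f v

/-- Cauchy–Schwarz for the splitting `q g = √(q f) · √(q g² / f)`. -/
theorem sum_sq_le_of_pos_finite {J : Type*} (s : Finset J) {q f g : J → ℝ≥0∞}
    (hq : ∀ j, q j ≠ ⊤) (hf : ∀ j, f j ≠ ⊤) (hf0 : ∀ j, f j ≠ 0) (hg : ∀ j, g j ≠ ⊤) :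
    (∑ j ∈ s, q j * g j) ^ 2 ≤ (∑ j ∈ s, q j * f j) * ∑ j ∈ s, q j * (g j ^ 2 * (f j)⁻¹) := by
  lift q to J → NNReal using hq
  lift f to J → NNReal using hf
  lift g to J → NNReal using hg
  have h0 : ∀ j, f j ≠ 0 := fun j h => hf0 j (by simp [h])
  have h := Finset.sum_sq_le_sum_mul_sum_of_sq_le_mul s (r := fun j => q j * g j)
    (f := fun j => q j * f j) (g := fun j => q j * (g j ^ 2 * (f j)⁻¹))
    (fun _ _ => zero_le) (fun _ _ => zero_le) fun j _ => le_of_eq (by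
      have := h0 j
      field_simp)
  simp only [← ENNReal.coe_inv (h0 _)]
  exact_mod_cast h

/-- Schur's test: a positive finite supersolution bounds the norm. -/
theorem L2Bound.of_supersolution (hτ : IsInverseClosed τ) (hq : ∀ i, q i ≠ ⊤) {M : ℝ≥0∞}
    (hM : M ≠ 0) {f : V → ℝ≥0∞} (hf : ∀ v, f v ≠ ⊤) (hf0 : ∀ v, f v ≠ 0)
    (h : ∀ v, letterSum τ q f v ≤ M * f v) : L2Bound τ q M := by
  intro g
  by_cases hg : ∑' v, g v ^ 2 = ⊤
  · rw [hg, ENNReal.mul_top (pow_ne_zero 2 hM)]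
    exact le_top
  have hg' : ∀ v, g v ≠ ⊤ := fun v hv => ENNReal.ne_top_of_tsum_ne_top hg v (by simp [hv])
  -- With `A` the letter sum, `(A g)² ≤ (A f) · A(g²/f) ≤ M f · A(g²/f)`; symmetry then moves `A`
  -- onto `f`, where the supersolution inequality applies a second time.
  calc ∑' v, letterSum τ q g v ^ 2
      ≤ ∑' v, M * (f v * letterSum τ q (fun v => g v ^ 2 * (f v)⁻¹) v) :=
        ENNReal.tsum_le_tsum fun v => by
          rw [← mul_assoc]
          exact (sum_sq_le_of_pos_finite _ (fun a : ι × Bool => hq a.1) (fun a => hf _)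
            (fun a => hf0 _) fun a => hg' _).trans (mul_le_mul_left (h v) _)
    _ = M * ∑' v, letterSum τ q f v * (g v ^ 2 * (f v)⁻¹) := by
        rw [ENNReal.tsum_mul_left, tsum_mul_letterSum hτ]
    _ ≤ M * ∑' v, M * g v ^ 2 := by
        refine mul_le_mul_right (ENNReal.tsum_le_tsum fun v => ?_) _
        refine (mul_le_mul_left (h v) _).trans (le_of_eq ?_)
        rw [mul_assoc, mul_left_comm (f v), ENNReal.mul_inv_cancel (hf0 v) (hf v), mul_one]
    _ = M ^ 2 * ∑' v, g v ^ 2 := by rw [ENNReal.tsum_mul_left, ← mul_assoc, sq]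

theorem L2Bound.iterate {M : ℝ≥0∞} (h : L2Bound τ q M) (f : V → ℝ≥0∞) (k : ℕ) :
    ∑' v, (letterSum τ q)^[k] f v ^ 2 ≤ (M ^ k) ^ 2 * ∑' v, f v ^ 2 := by
  induction k with
  | zero => simp
  | succ k ih =>
    simp only [Function.iterate_succ_apply']
    refine (h _).trans ((mul_le_mul_right ih _).trans (le_of_eq ?_))
    ring

theorem le_of_tsum_sq_le {f : V → ℝ≥0∞} {C : ℝ≥0∞} (h : ∑' v, f v ^ 2 ≤ C ^ 2) (v : V) :
    f v ≤ C := by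
  have := (ENNReal.le_tsum v).trans h
  exact (ENNReal.pow_le_pow_left_iff two_ne_zero).mp this

open Classical in
/-- The indicator function of the point `o`. -/
def delta (o v : V) : ℝ≥0∞ := if v = o then 1 else 0

theorem delta_self (o : V) : delta o o = 1 := if_pos rfl

theorem delta_of_ne {o v : V} (h : v ≠ o) : delta o v = 0 := if_neg h

theorem delta_congr {o v : V} {o' v' : W} (h : v = o ↔ v' = o') : delta o v = delta o' v' := by
  by_cases hv : v = o
  · rw [hv, h.mp hv, delta_self, delta_self]
  · rw [delta_of_ne hv, delta_of_ne (mt h.mpr hv)]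

theorem tsum_mul_delta (f : V → ℝ≥0∞) (o : V) : ∑' v, f v * delta o v = f o := by
  rw [tsum_eq_single o fun v hv => by rw [delta_of_ne hv, mul_zero], delta_self, mul_one]

theorem tsum_delta (o : V) : ∑' v, delta o v = 1 := by
  simpa using tsum_mul_delta (fun _ => 1) o

theorem tsum_delta_sq (o : V) : ∑' v, delta o v ^ 2 = 1 := by
  rw [tsum_eq_single o fun v hv => by rw [delta_of_ne hv]; simp, delta_self, one_pow]

theorem L2Bound.iterate_delta_le {M : ℝ≥0∞} (h : L2Bound τ q M) (o v : V) (k : ℕ) :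
    (letterSum τ q)^[k] (delta o) v ≤ M ^ k :=
  le_of_tsum_sq_le (by simpa [tsum_delta_sq] using h.iterate (delta o) k) v

/-- Every point is reached from `o` by steps along letters. -/
def IsConnectedFrom (τ : ι × Bool → Equiv.Perm V) (o : V) : Prop :=
  ∀ S : Set V, o ∈ S → (∀ v ∈ S, ∀ a, τ a v ∈ S) → ∀ v, v ∈ S

theorem mul_le_letterSum (f : V → ℝ≥0∞) (a : ι × Bool) (v : V) :
    q a.1 * f (τ a v) ≤ letterSum τ q f v :=
  Finset.single_le_sum (f := fun a => q a.1 * f (τ a v)) (fun _ _ => zero_le)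
    (Finset.mem_univ a)

/-- The inequality bounds each neighbour's value by a finite multiple of the value at the point, so
finiteness spreads along edges; in the next lemma nonvanishing spreads by using the reverse edge. -/
theorem supersolution_ne_top {o : V} (ho : IsConnectedFrom τ o) (hq0 : ∀ i, q i ≠ 0)
    {M : ℝ≥0∞} (hM : M ≠ ⊤) {f : V → ℝ≥0∞} (h : ∀ v, letterSum τ q f v ≤ M * f v)
    (hfo : f o ≠ ⊤) (v : V) : f v ≠ ⊤ := by
  refine ho {v | f v ≠ ⊤} hfo (fun v hv a => ?_) v
  have h1 := ((mul_le_letterSum f a v).trans (h v)).trans_lt (ENNReal.mul_lt_top hM.lt_top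
    (lt_top_iff_ne_top.mpr hv))
  intro h2
  rw [h2, ENNReal.mul_top (hq0 _)] at h1
  exact lt_irrefl _ h1

theorem supersolution_ne_zero {o : V} (hτ : IsInverseClosed τ) (ho : IsConnectedFrom τ o)
    (hq0 : ∀ i, q i ≠ 0) {M : ℝ≥0∞} {f : V → ℝ≥0∞} (h : ∀ v, letterSum τ q f v ≤ M * f v)
    (hfo : f o ≠ 0) (v : V) : f v ≠ 0 := by
  refine ho {v | f v ≠ 0} hfo (fun v hv a h0 => ?_) v
  have h1 := (mul_le_letterSum f (a.1, !a.2) (τ a v)).trans (h (τ a v))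
  rw [h0, mul_zero, hτ, Equiv.symm_apply_apply] at h1
  rcases mul_eq_zero.mp (le_antisymm h1 (zero_le)) with h2 | h2
  · exact hq0 _ h2
  · exact hv h2

theorem tsum_pow_succ_lt_top {x y : ℝ≥0∞} (h : x < y) (hy : y ≠ ⊤) :
    ∑' k : ℕ, y⁻¹ ^ (k + 1) * x ^ k < ⊤ := by
  have hy0 : y ≠ 0 := h.bot_lt.ne'
  have e : ∀ k : ℕ, y⁻¹ ^ (k + 1) * x ^ k = y⁻¹ * (y⁻¹ * x) ^ k := fun k => by
    rw [mul_pow]; ring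
  simp only [e]
  rw [ENNReal.tsum_mul_left, ENNReal.tsum_geometric]
  refine ENNReal.mul_lt_top (ENNReal.inv_lt_top.mpr hy0.bot_lt) (ENNReal.inv_lt_top.mpr ?_)
  rw [tsub_pos_iff_lt, mul_comm, ← div_eq_mul_inv]
  exact (ENNReal.div_lt_iff (Or.inl hy0) (Or.inl hy)).mpr (by rwa [one_mul])

/-- The Neumann series yields positive finite supersolutions for every number above a bound of
the norm. -/
theorem L2Bound.exists_supersolution (hτ : IsInverseClosed τ) {o : V}
    (ho : IsConnectedFrom τ o) (hq0 : ∀ i, q i ≠ 0) {M M' : ℝ≥0∞} (hMM : M < M') (hM' : M' ≠ ⊤)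
    (hM : L2Bound τ q M) :
    ∃ f : V → ℝ≥0∞, (∀ v, f v ≠ ⊤) ∧ (∀ v, f v ≠ 0) ∧ ∀ v, letterSum τ q f v ≤ M' * f v := by
  have hM0 : M' ≠ 0 := hMM.bot_lt.ne'
  -- The resolvent `(M' - A)⁻¹ δ_o`, which satisfies `A f = M' f - δ_o`; it is finite because `A^k
  -- δ_o ≤ M^k` pointwise.
  let f : V → ℝ≥0∞ := fun v => ∑' k : ℕ, M'⁻¹ ^ (k + 1) * (letterSum τ q)^[k] (delta o) v
  have hf : ∀ v, f v ≠ ⊤ := fun v => ((ENNReal.tsum_le_tsum fun k =>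
    mul_le_mul_right (hM.iterate_delta_le o v k) _).trans_lt (tsum_pow_succ_lt_top hMM hM')).ne
  have hs : ∀ v, letterSum τ q f v ≤ M' * f v := fun v => by
    have h1 : letterSum τ q f v =
        ∑' k : ℕ, M' * (M'⁻¹ ^ (k + 1 + 1) * (letterSum τ q)^[k + 1] (delta o) v) := by
      rw [letterSum_tsum]
      refine tsum_congr fun k => ?_
      rw [letterSum_const_mul, Function.iterate_succ_apply', pow_succ' M'⁻¹ (k + 1), ← mul_assoc,
        ← mul_assoc, ENNReal.mul_inv_cancel hM0 hM', one_mul]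
    rw [h1, ENNReal.tsum_mul_left]
    exact mul_le_mul_right (ENNReal.tsum_comp_le_tsum_of_injective (add_left_injective 1)
      fun k : ℕ => M'⁻¹ ^ (k + 1) * (letterSum τ q)^[k] (delta o) v) _
  refine ⟨f, hf, supersolution_ne_zero hτ ho hq0 hs fun h0 => ?_, hs⟩
  have h1 := ENNReal.tsum_eq_zero.mp h0 0
  simp [delta_self, hM'] at h1

end LetterSum

/-! ### Coverings -/

section Covering

variable {ι X V : Type*} [Fintype ι] {θ : ι × Bool → Equiv.Perm X} {τ : ι × Bool → Equiv.Perm V}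
  {π : X → V} {q : ι → ℝ≥0∞}

/-- Norms do not increase when passing to a covering. -/
theorem L2Bound.of_covering (hπ : ∀ a x, π (θ a x) = τ a (π x)) (hθ : IsInverseClosed θ)
    (hτ : IsInverseClosed τ) {o : V} (ho : IsConnectedFrom τ o) (hq0 : ∀ i, q i ≠ 0)
    (hq : ∀ i, q i ≠ ⊤) {M M' : ℝ≥0∞} (hMM : M < M') (hM' : M' ≠ ⊤) (hM : L2Bound τ q M) :
    L2Bound θ q M' := by
  obtain ⟨f, hf, hf0, h⟩ := hM.exists_supersolution hτ ho hq0 hMM hM'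
  -- A supersolution downstairs lifts to one upstairs by composition with `π`. The lift need not be
  -- square-summable, and Schur's test does not ask for that.
  refine L2Bound.of_supersolution hθ hq hMM.bot_lt.ne' (f := fun x => f (π x))
    (fun _ => hf _) (fun _ => hf0 _) fun x => ?_
  simpa only [letterSum, hπ] using h (π x)

/-- The sum of `f` over the fibres of `π`. -/
def fibreSum (π : X → V) (f : X → ℝ≥0∞) (v : V) : ℝ≥0∞ := ∑' x, f x * delta v (π x)

theorem le_fibreSum (f : X → ℝ≥0∞) (x : X) : f x ≤ fibreSum π f (π x) := by
  refine le_trans (le_of_eq ?_) (ENNReal.le_tsum x)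
  rw [delta_self, mul_one]

/-- `θ a` carries the fibre over `v` bijectively onto the fibre over `τ a v`. -/
theorem fibreSum_letterSum (hπ : ∀ a x, π (θ a x) = τ a (π x)) (f : X → ℝ≥0∞) :
    fibreSum π (letterSum θ q f) = letterSum τ q (fibreSum π f) := by
  funext v
  simp only [fibreSum, letterSum, Finset.sum_mul]
  rw [Summable.tsum_finsetSum fun _ _ => ENNReal.summable]
  refine Finset.sum_congr rfl fun a _ => ?_
  rw [← ENNReal.tsum_mul_left, ← (θ a).tsum_eq fun x => q a.1 * (f x * delta (τ a v) (π x))]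
  refine tsum_congr fun x => ?_
  have : delta (τ a v) (π (θ a x)) = delta v (π x) :=
    delta_congr (by rw [hπ, EmbeddingLike.apply_eq_iff_eq])
  rw [this, mul_assoc]

theorem fibreSum_iterate (hπ : ∀ a x, π (θ a x) = τ a (π x)) (f : X → ℝ≥0∞) (k : ℕ) :
    fibreSum π ((letterSum θ q)^[k] f) = (letterSum τ q)^[k] (fibreSum π f) := by
  induction k with
  | zero => rfl
  | succ k ih =>
    rw [Function.iterate_succ_apply', Function.iterate_succ_apply', fibreSum_letterSum hπ, ih]

theorem fibreSum_delta (o : X) : fibreSum π (delta o) = delta (π o) := by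
  funext v
  have : ∀ x, delta o x * delta v (π x) = delta v (π x) * delta o x := fun x => mul_comm _ _
  simp only [fibreSum, this]
  rw [tsum_mul_delta fun x => delta v (π x)]
  exact delta_congr eq_comm

/-- `f` is a Green function with pole of mass `d` at `o`. -/
def IsGreen (θ : ι × Bool → Equiv.Perm X) (q : ι → ℝ≥0∞) (d : ℝ≥0∞) (o : X) (f : X → ℝ≥0∞) :
    Prop :=
  ∀ x, f x = letterSum θ q f x + d * delta o x

theorem IsGreen.fibreSum {d : ℝ≥0∞} {o : X} {f : X → ℝ≥0∞} (hf : IsGreen θ q d o f)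
    (hπ : ∀ a x, π (θ a x) = τ a (π x)) : IsGreen τ q d (π o) (fibreSum π f) := by
  intro v
  rw [← fibreSum_letterSum hπ, ← fibreSum_delta]
  simp only [WeightedCogrowth.fibreSum]
  rw [← ENNReal.tsum_mul_left, ← ENNReal.tsum_add]
  refine tsum_congr fun x => ?_
  rw [← mul_assoc, ← add_mul, ← hf x]

/-- Iterating `f = A f + d δ_o`; the remainder `A^N f` is all that separates `f` from its Neumann
series. -/
theorem IsGreen.eq_sum_add_iterate {d : ℝ≥0∞} {o : X} {f : X → ℝ≥0∞} (hf : IsGreen θ q d o f)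
    (N : ℕ) (x : X) : f x = ∑ k ∈ Finset.range N, d * (letterSum θ q)^[k] (delta o) x +
      (letterSum θ q)^[N] f x := by
  induction N generalizing x with
  | zero => simp
  | succ N ih =>
    have h1 : ∀ N, (letterSum θ q)^[N] f =
        fun x => (letterSum θ q)^[N + 1] f x + d * (letterSum θ q)^[N] (delta o) x := by
      intro N
      induction N with
      | zero => exact funext hf
      | succ N ih =>
        rw [Function.iterate_succ_apply', ih, letterSum_add, letterSum_const_mul]
        simp only [Function.iterate_succ_apply']
    rw [ih x, Finset.sum_range_succ, congrFun (h1 N) x, add_assoc, add_comm (d * _)]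

/-- If the iterates of a Green function tend to zero, then its fibre sums are finite as soon as
the norm downstairs is less than one. -/
theorem IsGreen.fibreSum_lt_top {d : ℝ≥0∞} {o : X} {f : X → ℝ≥0∞} (hf : IsGreen θ q d o f)
    (hd : d ≠ ⊤) (hπ : ∀ a x, π (θ a x) = τ a (π x))
    (h0 : ∀ x, Filter.Tendsto (fun N => (letterSum θ q)^[N] f x) Filter.atTop (nhds 0))
    {M : ℝ≥0∞} (hM : M < 1) (h : L2Bound τ q M) (v : V) : WeightedCogrowth.fibreSum π f v < ⊤ := by
  have h1 : ∀ x, f x ≤ ∑' k, d * (letterSum θ q)^[k] (delta o) x := fun x => by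
    have h2 : Filter.Tendsto (fun N => ∑' k, d * (letterSum θ q)^[k] (delta o) x +
        (letterSum θ q)^[N] f x) Filter.atTop
        (nhds (∑' k, d * (letterSum θ q)^[k] (delta o) x + 0)) :=
      tendsto_const_nhds.add (h0 x)
    rw [add_zero] at h2
    refine ge_of_tendsto' h2 fun N => ?_
    conv_lhs => rw [hf.eq_sum_add_iterate N x]
    exact add_le_add_left (ENNReal.sum_le_tsum _) _
  calc WeightedCogrowth.fibreSum π f v
      ≤ ∑' x, (∑' k, d * (letterSum θ q)^[k] (delta o) x) * delta v (π x) :=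
        ENNReal.tsum_le_tsum fun x => mul_le_mul_left (h1 x) _
    _ = ∑' k, d * WeightedCogrowth.fibreSum π ((letterSum θ q)^[k] (delta o)) v := by
        simp only [WeightedCogrowth.fibreSum, ← ENNReal.tsum_mul_right, ← ENNReal.tsum_mul_left]
        rw [ENNReal.tsum_comm]
        simp only [mul_assoc]
    _ ≤ ∑' k : ℕ, d * M ^ k := ENNReal.tsum_le_tsum fun k => mul_le_mul_right (by
        rw [fibreSum_iterate hπ, fibreSum_delta]
        exact h.iterate_delta_le _ _ k) _
    _ < ⊤ := by
        rw [ENNReal.tsum_mul_left, ENNReal.tsum_geometric]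
        exact ENNReal.mul_lt_top hd.lt_top (ENNReal.inv_lt_top.mpr (tsub_pos_iff_lt.mpr hM))

/-- The `ℓ²` norms decay geometrically, and they dominate the pointwise values. -/
theorem L2Bound.tendsto_iterate {M : ℝ≥0∞} (h : L2Bound θ q M) (hM : M < 1) {f : X → ℝ≥0∞}
    (hf : ∑' x, f x ^ 2 ≠ ⊤) (x : X) :
    Filter.Tendsto (fun N => (letterSum θ q)^[N] f x) Filter.atTop (nhds 0) := by
  have h1 : Filter.Tendsto (fun N : ℕ => M ^ N * (∑' x, f x ^ 2) ^ (1 / 2 : ℝ)) Filter.atTop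
      (nhds (0 * (∑' x, f x ^ 2) ^ (1 / 2 : ℝ))) :=
    ENNReal.Tendsto.mul_const (ENNReal.tendsto_pow_atTop_nhds_zero_of_lt_one hM)
      (Or.inr (ENNReal.rpow_ne_top_of_nonneg (by norm_num) hf))
  rw [zero_mul] at h1
  refine tendsto_of_tendsto_of_tendsto_of_le_of_le tendsto_const_nhds h1 (fun _ => zero_le)
    fun N => le_of_tsum_sq_le ((h.iterate f N).trans (le_of_eq ?_)) x
  rw [mul_pow, ← ENNReal.rpow_natCast (_ ^ (1 / 2 : ℝ)), ← ENNReal.rpow_mul]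
  norm_num

/-- A square-summable Green function is bounded in terms of the norm. -/
theorem IsGreen.tsum_sq_le {d : ℝ≥0∞} {o : X} {f : X → ℝ≥0∞} (hf : IsGreen θ q d o f)
    (hfin : ∑' x, f x ^ 2 ≠ ⊤) {M : ℝ≥0∞} (hM0 : M ≠ 0) (hM : M < 1) (h : L2Bound θ q M) :
    ∑' x, f x ^ 2 ≤ d * f o / (1 - M) := by
  have hMt : M ≠ ⊤ := (hM.trans ENNReal.one_lt_top).ne
  have hft : ∀ x, f x ≠ ⊤ := fun x hx => ENNReal.ne_top_of_tsum_ne_top hfin x (by simp [hx])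
  have hgt : ∀ x, letterSum θ q f x ≠ ⊤ := fun x =>
    ne_top_of_le_ne_top (hft x) (by conv_rhs => rw [hf x]
                                    exact le_self_add)
  -- The aim is `(1 - M)‖f‖² ≤ ⟨f, f⟩ - ⟨f, A f⟩ = d f(o)`. This weighted AM–GM replaces
  -- Cauchy–Schwarz: with `‖A f‖ ≤ M ‖f‖` each of the two terms sums to at most `M ‖f‖²`.
  have amgm : ∀ x, 2 * (f x * letterSum θ q f x) ≤
      M * f x ^ 2 + M⁻¹ * letterSum θ q f x ^ 2 := fun x => by
    have h1 := hft x
    have h2 := hgt x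
    generalize f x = s at h1 ⊢
    generalize letterSum θ q f x = t at h2 ⊢
    lift s to NNReal using h1
    lift t to NNReal using h2
    lift M to NNReal using hMt
    have hM1 : M ≠ 0 := fun h => hM0 (by simp [h])
    rw [← ENNReal.coe_inv hM1]
    norm_cast
    have hM2 : (0 : ℝ) < M := by positivity
    rw [← NNReal.coe_le_coe]
    push_cast
    have : (M : ℝ) * s ^ 2 + (M : ℝ)⁻¹ * t ^ 2 - 2 * (s * t) = (M : ℝ)⁻¹ * (M * s - t) ^ 2 := by
      field_simp
      ring
    have h3 : 0 ≤ (M : ℝ)⁻¹ * (M * s - t) ^ 2 := by positivity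
    linarith
  have h1 : 2 * ∑' x, f x ^ 2 ≤ 2 * (M * ∑' x, f x ^ 2 + d * f o) := by
    calc 2 * ∑' x, f x ^ 2
        = ∑' x, (2 * (f x * letterSum θ q f x) + 2 * d * (f x * delta o x)) := by
          rw [← ENNReal.tsum_mul_left]
          refine tsum_congr fun x => ?_
          rw [sq]
          conv_lhs => enter [2, 2]; rw [hf x]
          ring
      _ ≤ ∑' x, ((M * f x ^ 2 + M⁻¹ * letterSum θ q f x ^ 2) + 2 * d * (f x * delta o x)) :=
          ENNReal.tsum_le_tsum fun x => add_le_add_left (amgm x) _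
      _ = M * ∑' x, f x ^ 2 + M⁻¹ * ∑' x, letterSum θ q f x ^ 2 + 2 * d * f o := by
          rw [ENNReal.tsum_add, ENNReal.tsum_add, ENNReal.tsum_mul_left, ENNReal.tsum_mul_left,
            ENNReal.tsum_mul_left, tsum_mul_delta]
      _ ≤ M * ∑' x, f x ^ 2 + M⁻¹ * (M ^ 2 * ∑' x, f x ^ 2) + 2 * d * f o := by
          gcongr
          exact h f
      _ = 2 * (M * ∑' x, f x ^ 2 + d * f o) := by
          rw [sq, ← mul_assoc M⁻¹, ← mul_assoc M⁻¹, ENNReal.inv_mul_cancel hM0 hMt, one_mul]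
          ring
  have h2 := (ENNReal.mul_le_mul_iff_right two_ne_zero ENNReal.ofNat_ne_top).mp h1
  rw [ENNReal.le_div_iff_mul_le (Or.inl (tsub_pos_iff_lt.mpr hM).ne') (Or.inl (by simp)),
    mul_comm, ENNReal.sub_mul fun _ _ => hfin, one_mul]
  exact tsub_le_iff_left.mpr h2

end Covering

/-! ### The Green function of the free group -/

section FreeGroupGreen

variable {n : ℕ}

/-- The product of the weights of the letters of the reduced word of `x`. -/
def wordWeight (u : Fin n → ℝ) (x : FreeGroup (Fin n)) : ℝ := (x.toWord.map fun a => u a.1).prod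

/-- The mass of the pole of the Green function `wordWeight u`. -/
def poleMass (u : Fin n → ℝ) : ℝ := 1 - eigenvalueOf u - 2 * ∑ k, u k * weightOf u k

/-- Right multiplication by a letter. -/
def letterPerm (a : Fin n × Bool) : Equiv.Perm (FreeGroup (Fin n)) :=
  Equiv.mulRight (FreeGroup.mk [a])

theorem mk_opposite (a : Fin n × Bool) :
    FreeGroup.mk [(a.1, !a.2)] = (FreeGroup.mk [a])⁻¹ := by
  rw [FreeGroup.inv_mk]; rfl

theorem isInverseClosed_letterPerm : IsInverseClosed (letterPerm (n := n)) := fun a => by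
  ext x
  simp only [letterPerm, mk_opposite, Equiv.mulRight_symm]

theorem wordWeight_one (u : Fin n → ℝ) : wordWeight u 1 = 1 := by
  simp [wordWeight]

theorem wordWeight_inv (u : Fin n → ℝ) (x : FreeGroup (Fin n)) :
    wordWeight u x⁻¹ = wordWeight u x := by
  simp only [wordWeight, FreeGroup.toWord_inv, FreeGroup.invRev, List.map_reverse, List.map_map,
    List.prod_reverse]
  rfl

theorem wordWeight_pos {u : Fin n → ℝ} (hu : ∀ i, 0 < u i) (x : FreeGroup (Fin n)) :
    0 < wordWeight u x := by
  refine List.prod_pos fun t ht => ?_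
  obtain ⟨a, -, rfl⟩ := List.mem_map.mp ht
  exact hu _

theorem wordWeight_le_one {u : Fin n → ℝ} (hu : ∀ i, 0 < u i ∧ u i < 1)
    (x : FreeGroup (Fin n)) : wordWeight u x ≤ 1 := by
  unfold wordWeight
  induction x.toWord with
  | nil => simp
  | cons a L ih =>
    rw [List.map_cons, List.prod_cons]
    have h0 : 0 ≤ (L.map fun a => u a.1).prod := List.prod_nonneg fun t ht => by
      obtain ⟨a, -, rfl⟩ := List.mem_map.mp ht
      exact (hu _).1.le
    nlinarith [hu a.1]

theorem toWord_letter_mul (b : Fin n × Bool) (y : FreeGroup (Fin n)) :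
    (FreeGroup.mk [b] * y).toWord = FreeGroup.reduce (b :: y.toWord) := by
  conv_lhs => rw [← FreeGroup.mk_toWord (x := y)]
  rw [FreeGroup.mul_mk, FreeGroup.toWord_mk, List.singleton_append]

theorem wordWeight_letter_mul_of_nil (u : Fin n → ℝ) {y : FreeGroup (Fin n)}
    (hy : y.toWord = []) (b : Fin n × Bool) : wordWeight u (FreeGroup.mk [b] * y) = u b.1 := by
  simp [wordWeight, toWord_letter_mul, hy]

theorem wordWeight_letter_mul_of_cons {u : Fin n → ℝ} (hu : ∀ i, u i ≠ 0)
    {y : FreeGroup (Fin n)} {a : Fin n × Bool} {L : List (Fin n × Bool)} (hy : y.toWord = a :: L)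
    (b : Fin n × Bool) : wordWeight u (FreeGroup.mk [b] * y) =
      wordWeight u y * (u b.1 + if b = (a.1, !a.2) then (u b.1)⁻¹ - u b.1 else 0) := by
  have hr : FreeGroup.reduce (a :: L) = a :: L := by rw [← hy, FreeGroup.reduce_toWord]
  have h := hu a.1
  simp only [wordWeight, toWord_letter_mul, hy]
  rw [FreeGroup.reduce.cons, hr]
  by_cases hb : b = (a.1, !a.2)
  · subst hb
    simp
    field_simp
  · have : ¬ (b.1 = a.1 ∧ b.2 = !a.2) := fun h => hb (Prod.ext h.1 h.2)
    simp [hb, this]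
    ring

theorem sum_letters (f : Fin n → ℝ) : ∑ a : Fin n × Bool, f a.1 = 2 * ∑ i, f i := by
  rw [Fintype.sum_prod_type, Finset.mul_sum]
  exact Finset.sum_congr rfl fun i _ => by simp [two_mul]

variable {u : Fin n → ℝ}

/-- The content of the linear system: the gain from cancelling a letter does not depend on the
letter. This is what makes `wordWeight u` an eigenfunction away from the identity. -/
theorem mul_weightOf_eq_poleMass (hn : 1 ≤ n) (hu : ∀ i, 0 < u i ∧ u i < 1) (i : Fin n) :
    ((u i)⁻¹ - u i) * weightOf u i = poleMass u := by
  have h := (((weightOf_spec hn u hu).2 _ _).mpr ⟨rfl, rfl⟩).1 i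
  rw [poleMass, ← h, coeff]
  ring

theorem poleMass_pos (hn : 1 ≤ n) (hu : ∀ i, 0 < u i ∧ u i < 1) : 0 < poleMass u := by
  rw [← mul_weightOf_eq_poleMass hn hu ⟨0, hn⟩]
  exact mul_pos (sub_pos.mpr ((hu _).2.trans (one_lt_inv₀ (hu _).1 |>.mpr (hu _).2)))
    ((weightOf_spec hn u hu).1.1 _)

theorem poleMass_lt (hn : 1 ≤ n) (hu : ∀ i, 0 < u i ∧ u i < 1) :
    poleMass u < 1 - eigenvalueOf u := by
  have : Nonempty (Fin n) := ⟨⟨0, hn⟩⟩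
  have : 0 < ∑ k, u k * weightOf u k := Finset.sum_pos
    (fun k _ => mul_pos (hu k).1 ((weightOf_spec hn u hu).1.1 _)) Finset.univ_nonempty
  rw [poleMass]
  linarith

theorem one_sub_eigenvalueOf_pos (hn : 1 ≤ n) (hu : ∀ i, 0 < u i ∧ u i < 1) :
    0 < 1 - eigenvalueOf u := (poleMass_pos hn hu).trans (poleMass_lt hn hu)

/-- Dividing `(u_i⁻¹ - u_i) p_i = c` by `1 + u_i⁻¹` gives `(1 - u_i) p_i = c u_i / (1 + u_i)`;
summing over `i` yields the formula. Since `c > 0`, the sign of `λ` is read off from the second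
factor. -/
theorem eigenvalueOf_eq (hn : 1 ≤ n) (hu : ∀ i, 0 < u i ∧ u i < 1) :
    eigenvalueOf u = poleMass u * (2 * ∑ i, u i / (1 + u i) - 1) := by
  have h1 : ∀ i, weightOf u i - u i * weightOf u i = poleMass u * (u i / (1 + u i)) := fun i => by
    rw [← mul_weightOf_eq_poleMass hn hu i]
    have := (hu i).1
    field_simp
    ring
  have h2 : ∑ i, (weightOf u i - u i * weightOf u i) = poleMass u * ∑ i, u i / (1 + u i) := by
    rw [Finset.mul_sum]
    exact Finset.sum_congr rfl fun i _ => h1 i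
  rw [Finset.sum_sub_distrib, (weightOf_spec hn u hu).1.2] at h2
  have h3 : poleMass u = 1 - eigenvalueOf u - 2 * ∑ k, u k * weightOf u k := rfl
  linarith

/-- Away from the identity exactly one neighbour is shorter, and its excess `u⁻¹ - u` over the
generic factor contributes the pole mass `c`. At the identity no letter cancels, so `c` is missing.
-/
theorem sum_weightOf_mul_wordWeight (hn : 1 ≤ n) (hu : ∀ i, 0 < u i ∧ u i < 1)
    (x : FreeGroup (Fin n)) :
    ∑ a : Fin n × Bool, weightOf u a.1 * wordWeight u (x * FreeGroup.mk [a]) =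
      (1 - eigenvalueOf u) * wordWeight u x - if x = 1 then poleMass u else 0 := by
  have h1 : ∑ a : Fin n × Bool, weightOf u a.1 * wordWeight u (x * FreeGroup.mk [a]) =
      ∑ b : Fin n × Bool, weightOf u b.1 * wordWeight u (FreeGroup.mk [b] * x⁻¹) := by
    -- Passing to inverses turns right multiplication into prepending a letter to a reduced word.
    let e : Fin n × Bool ≃ Fin n × Bool := Equiv.prodCongr (Equiv.refl _) Equiv.boolNot
    rw [← e.sum_comp]
    refine Finset.sum_congr rfl fun a _ => ?_
    change weightOf u a.1 * wordWeight u (x * FreeGroup.mk [(a.1, !a.2)]) = _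
    rw [← wordWeight_inv u (x * _), mul_inv_rev, mk_opposite, inv_inv]
  have h2 : 2 * ∑ k, u k * weightOf u k = 1 - eigenvalueOf u - poleMass u := by
    rw [poleMass]; ring
  rw [← sum_letters fun k => u k * weightOf u k] at h2
  rw [h1]
  rcases hy : x⁻¹.toWord with _ | ⟨a, L⟩
  · have hx : x = 1 := inv_eq_one.mp (FreeGroup.toWord_eq_nil_iff.mp hy)
    simp only [wordWeight_letter_mul_of_nil u hy]
    rw [if_pos hx, hx, wordWeight_one, mul_one, ← h2]
    exact Finset.sum_congr rfl fun _ _ => mul_comm _ _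
  · have hx : x ≠ 1 := fun hx => by simp [hx] at hy
    simp only [wordWeight_letter_mul_of_cons (fun i => (hu i).1.ne') hy]
    rw [if_neg hx, wordWeight_inv, sub_zero]
    have h3 : ∀ b : Fin n × Bool, weightOf u b.1 * (wordWeight u x *
        (u b.1 + if b = (a.1, !a.2) then (u b.1)⁻¹ - u b.1 else 0)) =
        wordWeight u x * (u b.1 * weightOf u b.1 +
          if b = (a.1, !a.2) then poleMass u else 0) := fun b => by
      split_ifs
      · rw [← mul_weightOf_eq_poleMass hn hu b.1]; ring
      · ring
    simp only [h3]
    rw [← Finset.mul_sum, Finset.sum_add_distrib, h2, Finset.sum_ite_eq' Finset.univ]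
    simp
    ring

/-- The weights of the normalized transition operator `A_p / (1 - λ)`. -/
def normWeight (u : Fin n → ℝ) (i : Fin n) : ℝ≥0∞ :=
  ENNReal.ofReal (weightOf u i / (1 - eigenvalueOf u))

theorem normWeight_ne_top (u : Fin n → ℝ) (i : Fin n) : normWeight u i ≠ ⊤ := ENNReal.ofReal_ne_top

theorem normWeight_ne_zero (hn : 1 ≤ n) (hu : ∀ i, 0 < u i ∧ u i < 1) (i : Fin n) :
    normWeight u i ≠ 0 :=
  (ENNReal.ofReal_pos.mpr (div_pos ((weightOf_spec hn u hu).1.1 _)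
    (one_sub_eigenvalueOf_pos hn hu))).ne'

theorem isGreen_wordWeight (hn : 1 ≤ n) (hu : ∀ i, 0 < u i ∧ u i < 1) :
    IsGreen letterPerm (normWeight u) (ENNReal.ofReal (poleMass u / (1 - eigenvalueOf u))) 1
      fun x => ENNReal.ofReal (wordWeight u x) := by
  intro x
  have hμ := one_sub_eigenvalueOf_pos hn hu
  have hc := poleMass_pos hn hu
  have hp := fun i => (weightOf_spec hn u hu).1.1 i
  have hw := fun x => wordWeight_pos (fun i => (hu i).1) x
  have h := sum_weightOf_mul_wordWeight hn hu x
  have h1 : letterSum letterPerm (normWeight u) (fun x => ENNReal.ofReal (wordWeight u x)) x =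
      ENNReal.ofReal (∑ a : Fin n × Bool, weightOf u a.1 / (1 - eigenvalueOf u) *
        wordWeight u (x * FreeGroup.mk [a])) := by
    rw [ENNReal.ofReal_sum_of_nonneg fun a _ =>
      mul_nonneg (div_pos (hp _) hμ).le (hw _).le]
    refine Finset.sum_congr rfl fun a _ => ?_
    rw [ENNReal.ofReal_mul (div_pos (hp _) hμ).le]
    rfl
  have h2 : ∑ a : Fin n × Bool, weightOf u a.1 / (1 - eigenvalueOf u) *
      wordWeight u (x * FreeGroup.mk [a]) = ((1 - eigenvalueOf u) * wordWeight u x -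
        if x = 1 then poleMass u else 0) / (1 - eigenvalueOf u) := by
    rw [← h, Finset.sum_div]
    exact Finset.sum_congr rfl fun a _ => by ring
  change ENNReal.ofReal (wordWeight u x) = _
  by_cases hx : x = 1
  · rw [h1, h2, if_pos hx, hx, delta_self, mul_one, ← ENNReal.ofReal_add, wordWeight_one]
    · congr 1
      field_simp
      ring
    · rw [wordWeight_one, mul_one]
      exact div_nonneg (sub_pos.mpr (poleMass_lt hn hu)).le hμ.le
    · exact (div_pos hc hμ).le
  · rw [h1, h2, if_neg hx, delta_of_ne hx, mul_zero, add_zero, sub_zero,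
      mul_div_cancel_left₀ _ hμ.ne']

theorem sum_normWeight (hn : 1 ≤ n) (hu : ∀ i, 0 < u i ∧ u i < 1) :
    ∑ a : Fin n × Bool, normWeight u a.1 = ENNReal.ofReal (1 / (1 - eigenvalueOf u)) := by
  have hμ := one_sub_eigenvalueOf_pos hn hu
  have hp := fun i => (weightOf_spec hn u hu).1.1 i
  simp only [normWeight]
  rw [← ENNReal.ofReal_sum_of_nonneg fun a _ => (div_pos (hp _) hμ).le,
    sum_letters fun i => weightOf u i / (1 - eigenvalueOf u), ← Finset.sum_div,
    (weightOf_spec hn u hu).1.2]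
  congr 1
  field_simp

/-- Summing the Green identity over the group gives `S = (S + c) / (1 - λ)` for the total sum `S`;
for finite `S` this forces `1 - λ > 1`. -/
theorem eigenvalueOf_neg_of_tsum_ne_top (hn : 1 ≤ n) (hu : ∀ i, 0 < u i ∧ u i < 1)
    (h : ∑' x, ENNReal.ofReal (wordWeight u x) ≠ ⊤) : eigenvalueOf u < 0 := by
  have hμ := one_sub_eigenvalueOf_pos hn hu
  by_contra! hl
  have h1 := tsum_congr (L := .unconditional _) (isGreen_wordWeight hn hu)
  rw [ENNReal.tsum_add, tsum_letterSum, ENNReal.tsum_mul_left, tsum_delta, mul_one,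
    sum_normWeight hn hu] at h1
  have h2 : (1 : ℝ≥0∞) ≤ ENNReal.ofReal (1 / (1 - eigenvalueOf u)) := by
    rw [ENNReal.one_le_ofReal, le_div_iff₀ hμ]
    linarith
  have h3 := (ENNReal.ofReal_pos.mpr (div_pos (poleMass_pos hn hu) hμ)).ne'
  have h4 : (∑' x, ENNReal.ofReal (wordWeight u x)) +
      ENNReal.ofReal (poleMass u / (1 - eigenvalueOf u)) ≤
      ∑' x, ENNReal.ofReal (wordWeight u x) := by
    conv_rhs => rw [h1]
    exact add_le_add_left (le_mul_of_one_le_left' h2) _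
  exact (ENNReal.lt_add_right h h3).not_ge h4

/-- For `λ < 0` the normalized weights have total mass below one and `w ≤ 1`, so the iterates of `w`
tend to zero uniformly. -/
theorem tsum_ne_top_of_eigenvalueOf_neg (hn : 1 ≤ n) (hu : ∀ i, 0 < u i ∧ u i < 1)
    (hl : eigenvalueOf u < 0) : ∑' x, ENNReal.ofReal (wordWeight u x) ≠ ⊤ := by
  have hμ := one_sub_eigenvalueOf_pos hn hu
  have hQ := sum_normWeight hn hu
  have hQ1 : ENNReal.ofReal (1 / (1 - eigenvalueOf u)) < 1 := by
    rw [ENNReal.ofReal_lt_one, div_lt_one hμ]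
    linarith
  have h1 : ∀ (N : ℕ) (x : FreeGroup (Fin n)), (letterSum letterPerm (normWeight u))^[N]
      (fun x => ENNReal.ofReal (wordWeight u x)) x ≤
      ENNReal.ofReal (1 / (1 - eigenvalueOf u)) ^ N := fun N => by
    induction N with
    | zero => simpa using fun x => wordWeight_le_one hu x
    | succ N ih =>
      intro x
      rw [Function.iterate_succ_apply', pow_succ', ← hQ, Finset.sum_mul, hQ]
      exact Finset.sum_le_sum fun a _ => mul_le_mul_right (ih _) _
  -- The map to a one-point graph is treated as a covering: its only fibre sum is the total sum, and
  -- the operator downstairs is multiplication by the total mass.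
  have h2 := (isGreen_wordWeight hn hu).fibreSum_lt_top ENNReal.ofReal_ne_top
    (π := fun _ => ()) (τ := fun _ => Equiv.refl Unit) (fun _ _ => rfl)
    (fun x => tendsto_of_tendsto_of_tendsto_of_le_of_le tendsto_const_nhds
      (ENNReal.tendsto_pow_atTop_nhds_zero_of_lt_one hQ1) (fun _ => zero_le) fun N => h1 N x) hQ1
    (fun f => by
      simp only [letterSum, Equiv.refl_apply, ← Finset.sum_mul, hQ, mul_pow]
      rw [ENNReal.tsum_mul_left]) ()
  simpa only [fibreSum, delta_self, mul_one] using h2.ne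

end FreeGroupGreen

/-! ### The quotient graph -/

section Quotient

variable {n : ℕ} (G : Subgroup (FreeGroup (Fin n)))

/-- The coset `G x`. -/
def coset (x : FreeGroup (Fin n)) : Vertex G := Quotient.mk _ x

/-- The step along a letter in the quotient graph. -/
def vertexStep (a : Fin n × Bool) : Equiv.Perm (Vertex G) := rightMul G (FreeGroup.mk [a])

theorem coset_letterPerm (a : Fin n × Bool) (x : FreeGroup (Fin n)) :
    coset G (letterPerm a x) = vertexStep G a (coset G x) := rfl

theorem rightMul_inv (g : FreeGroup (Fin n)) : rightMul G g⁻¹ = (rightMul G g).symm := by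
  ext v
  rfl

theorem isInverseClosed_vertexStep : IsInverseClosed (vertexStep G) := fun a => by
  rw [vertexStep, vertexStep, mk_opposite, rightMul_inv]

theorem isConnectedFrom_vertexStep : IsConnectedFrom (vertexStep G) (coset G 1) := by
  intro S h1 hS v
  obtain ⟨x, rfl⟩ : ∃ x, coset G x = v := Quotient.exists_rep v
  obtain ⟨L, rfl⟩ : ∃ L, FreeGroup.mk L = x := ⟨x.toWord, FreeGroup.mk_toWord⟩
  induction L using List.reverseRecOn with
  | nil => exact h1
  | append_singleton L a ih =>
    rw [← FreeGroup.mul_mk]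
    exact hS _ ih a

theorem coset_eq_coset_one_iff (x : FreeGroup (Fin n)) : coset G x = coset G 1 ↔ x ∈ G := by
  rw [coset, coset, Quotient.eq, QuotientGroup.rightRel_apply, one_mul, inv_mem_iff]

/-- The fibre over the trivial coset is `G`, so for `f = wordWeight (H r s)` this value is the
Poincaré series. -/
theorem fibreSum_coset_one (f : FreeGroup (Fin n) → ℝ≥0∞) :
    fibreSum (coset G) f (coset G 1) = ∑' g : G, f g := by
  change _ = ∑' g : (G : Set (FreeGroup (Fin n))), f g
  rw [tsum_subtype]
  refine tsum_congr fun x => ?_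
  by_cases hx : x ∈ G
  · rw [Set.indicator_of_mem (by exact hx), (coset_eq_coset_one_iff G x).mpr hx, delta_self,
      mul_one]
  · rw [Set.indicator_of_notMem (by exact hx), delta_of_ne (mt (coset_eq_coset_one_iff G x).mp hx),
      mul_zero]

end Quotient

/-! ### The Poincaré series -/

section Poincare

variable {n : ℕ}

/-- The length of the reduced word of `x`. -/
def wordLength (r : Fin n → ℝ) (x : FreeGroup (Fin n)) : ℝ := pathLength r x.toWord

variable {r : Fin n → ℝ}

theorem le_half_of_mem_paramSet (hr : r ∈ paramSet n) (i : Fin n) : r i ≤ 1 / 2 := by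
  rw [← hr.2]
  exact Finset.single_le_sum (fun j _ => (hr.1 j).le) (Finset.mem_univ i)

theorem neg_log_pos (hr : r ∈ paramSet n) (i : Fin n) : 0 < -Real.log (r i) :=
  neg_pos.mpr (Real.log_neg (hr.1 i) (by linarith [le_half_of_mem_paramSet hr i]))

theorem pathLength_nonneg (hr : r ∈ paramSet n) (w : List (Fin n × Bool)) :
    0 ≤ pathLength r w := List.sum_nonneg fun t ht => by
  obtain ⟨a, -, rfl⟩ := List.mem_map.mp ht
  exact (neg_log_pos hr _).le

/-- Reduction only deletes letters, and all edge lengths are positive, so the reduced word is a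
shortest path. -/
theorem pathDist_one_eq (hr : r ∈ paramSet n) (x : FreeGroup (Fin n)) :
    pathDist r 1 x = wordLength r x := by
  refine IsLeast.csInf_eq ⟨⟨x.toWord, by simp [FreeGroup.mk_toWord], rfl⟩, ?_⟩
  rintro _ ⟨w, hw, rfl⟩
  rw [Set.mem_ofPred_eq, one_mul] at hw
  rw [wordLength, ← hw, FreeGroup.toWord_mk]
  refine List.Sublist.sum_le_sum (FreeGroup.reduce.red.sublist.map _) fun t ht => ?_
  obtain ⟨a, -, rfl⟩ := List.mem_map.mp ht
  exact (neg_log_pos hr _).le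

theorem H_mem (hr : r ∈ paramSet n) {s : ℝ} (hs : 0 < s) (i : Fin n) :
    0 < H r s i ∧ H r s i < 1 :=
  ⟨Real.rpow_pos_of_pos (hr.1 i) s, Real.rpow_lt_one (hr.1 i).le
    (by linarith [le_half_of_mem_paramSet hr i]) hs⟩

theorem wordWeight_H (hr : r ∈ paramSet n) (s : ℝ) (x : FreeGroup (Fin n)) :
    wordWeight (H r s) x = Real.exp (-s * wordLength r x) := by
  unfold wordWeight wordLength pathLength
  induction x.toWord with
  | nil => simp
  | cons a L ih =>
    rw [List.map_cons, List.prod_cons, ih, List.map_cons, List.sum_cons, mul_add, Real.exp_add, H,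
      Real.rpow_def_of_pos (hr.1 _)]
    congr 2
    ring

theorem wordWeight_H_sq (hr : r ∈ paramSet n) (s : ℝ) (x : FreeGroup (Fin n)) :
    wordWeight (H r s) x ^ 2 = wordWeight (H r (2 * s)) x := by
  rw [wordWeight_H hr, wordWeight_H hr, ← Real.exp_nat_mul]
  congr 1
  push_cast
  ring

/-- The Poincaré series of `G` at `s`. -/
def poincareSeries (G : Subgroup (FreeGroup (Fin n))) (r : Fin n → ℝ) (s : ℝ) : ℝ≥0∞ :=
  ∑' g : G, ENNReal.ofReal (wordWeight (H r s) g)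

theorem poincareSeries_top (r : Fin n → ℝ) (s : ℝ) :
    poincareSeries ⊤ r s = ∑' x, ENNReal.ofReal (wordWeight (H r s) x) :=
  tsum_univ (f := fun x => ENNReal.ofReal (wordWeight (H r s) x))

theorem poincareSeries_le_top (G : Subgroup (FreeGroup (Fin n))) (r : Fin n → ℝ) (s : ℝ) :
    poincareSeries G r s ≤ poincareSeries ⊤ r s := by
  rw [poincareSeries_top]
  exact ENNReal.tsum_comp_le_tsum_of_injective Subtype.val_injective
    fun x => ENNReal.ofReal (wordWeight (H r s) x)

/-- At `s = 1` one has `∑ r_i / (1 + r_i) < ∑ r_i = 1/2`. Hence every Poincaré series converges at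
`1`. -/
theorem eigenvalueOf_H_one_neg (hn : 1 ≤ n) (hr : r ∈ paramSet n) :
    eigenvalueOf (H r 1) < 0 := by
  have hu := H_mem hr one_pos
  have : Nonempty (Fin n) := ⟨⟨0, hn⟩⟩
  rw [eigenvalueOf_eq hn hu]
  refine mul_neg_of_pos_of_neg (poleMass_pos hn hu) ?_
  have h1 : ∑ i, H r 1 i / (1 + H r 1 i) < ∑ i, r i :=
    Finset.sum_lt_sum_of_nonempty Finset.univ_nonempty fun i _ => by
      have hi := hr.1 i
      simp only [H, Real.rpow_one]
      rw [div_lt_iff₀ (by linarith)]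
      nlinarith
  rw [hr.2] at h1
  linarith

/-- The elements of `G` in the ball of radius `R`. -/
def orbitBall (G : Subgroup (FreeGroup (Fin n))) (r : Fin n → ℝ) (R : ℝ) :
    Set (FreeGroup (Fin n)) := {g | g ∈ G ∧ pathDist r 1 g ≤ R}

variable {G : Subgroup (FreeGroup (Fin n))}

/-- Markov's inequality: each element of the ball contributes at least `exp(-s R)` to the series. -/
theorem encard_orbitBall_mul_le (hr : r ∈ paramSet n) {s : ℝ} (hs : 0 < s) (R : ℝ) :
    ((orbitBall G r R).encard : ℝ≥0∞) * ENNReal.ofReal (Real.exp (-s * R)) ≤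
      poincareSeries G r s := by
  rw [← ENNReal.tsum_set_const]
  calc ∑' _ : orbitBall G r R, ENNReal.ofReal (Real.exp (-s * R))
      ≤ ∑' g : orbitBall G r R, ENNReal.ofReal (wordWeight (H r s) g) := by
        refine ENNReal.tsum_le_tsum fun g => ENNReal.ofReal_le_ofReal ?_
        rw [wordWeight_H hr, Real.exp_le_exp]
        have := g.2.2
        rw [pathDist_one_eq hr] at this
        nlinarith
    _ ≤ poincareSeries G r s := ENNReal.tsum_comp_le_tsum_of_injective
        (f := fun g : orbitBall G r R => (⟨g.1, g.2.1⟩ : G))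
        (fun g h e => Subtype.ext (congrArg (fun x : G => x.1) e))
        fun g : G => ENNReal.ofReal (wordWeight (H r s) g)

theorem poincareSeries_one_ne_top (hn : 1 ≤ n) (hr : r ∈ paramSet n) :
    poincareSeries G r 1 ≠ ⊤ :=
  ne_top_of_le_ne_top (by
    rw [poincareSeries_top]
    exact tsum_ne_top_of_eigenvalueOf_neg hn (H_mem hr one_pos) (eigenvalueOf_H_one_neg hn hr))
    (poincareSeries_le_top G r 1)

/-- Needed because `ncard` of an infinite set is `0`; only for finite balls does the exponent count
elements. -/
theorem finite_orbitBall (hn : 1 ≤ n) (hr : r ∈ paramSet n) (R : ℝ) :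
    (orbitBall G r R).Finite := by
  have h := (encard_orbitBall_mul_le (G := G) hr one_pos R).trans_lt
    (poincareSeries_one_ne_top hn hr).lt_top
  by_contra hinf
  rw [Set.encard_eq_top_iff.mpr hinf, ENat.toENNReal_top, ENNReal.top_mul] at h
  · exact lt_irrefl _ h
  · exact (ENNReal.ofReal_pos.mpr (Real.exp_pos _)).ne'

theorem log_ncard_orbitBall_le (hn : 1 ≤ n) (hr : r ∈ paramSet n) {s : ℝ} (hs : 0 < s)
    (h : poincareSeries G r s ≠ ⊤) :
    ∃ C : ℝ, ∀ R, 0 ≤ R → Real.log ((orbitBall G r R).ncard : ℝ) ≤ C + s * R := by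
  -- The maximum with `1` makes the constant nonnegative, which covers the default value `log 0 =
  -- 0`.
  refine ⟨Real.log (max 1 (poincareSeries G r s).toReal), fun R hR => ?_⟩
  have h1 := encard_orbitBall_mul_le (G := G) hr hs R
  rw [← (finite_orbitBall hn hr R).cast_ncard_eq, ENat.toENNReal_coe] at h1
  have h2 := ENNReal.toReal_mono h h1
  rw [ENNReal.toReal_mul, ENNReal.toReal_natCast, ENNReal.toReal_ofReal (Real.exp_pos _).le] at h2
  have hmax : 0 < max 1 (poincareSeries G r s).toReal := lt_max_of_lt_left one_pos
  rcases Nat.eq_zero_or_pos (orbitBall G r R).ncard with h0 | h0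
  · rw [h0, Nat.cast_zero, Real.log_zero]
    exact add_nonneg (Real.log_nonneg (le_max_left _ _)) (by positivity)
  · rw [← Real.log_exp (s * R), ← Real.log_mul hmax.ne' (Real.exp_pos _).ne']
    refine Real.log_le_log (by exact_mod_cast h0) ?_
    have h3 : Real.exp (-s * R) * Real.exp (s * R) = 1 := by
      rw [← Real.exp_add]; simp
    calc ((orbitBall G r R).ncard : ℝ)
        = (orbitBall G r R).ncard * Real.exp (-s * R) * Real.exp (s * R) := by
          rw [mul_assoc, h3, mul_one]
      _ ≤ max 1 (poincareSeries G r s).toReal * Real.exp (s * R) :=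
          mul_le_mul_of_nonneg_right (h2.trans (le_max_right _ _)) (Real.exp_pos _).le

theorem eventually_log_ncard_div_le (hn : 1 ≤ n) (hr : r ∈ paramSet n) {s t : ℝ} (hs : 0 < s)
    (h : poincareSeries G r s ≠ ⊤) (hst : s < t) :
    ∀ᶠ R in Filter.atTop, Real.log ((orbitBall G r R).ncard : ℝ) / R ≤ t := by
  obtain ⟨C, hC⟩ := log_ncard_orbitBall_le hn hr hs h
  filter_upwards [Filter.eventually_ge_atTop (C / (t - s)), Filter.eventually_gt_atTop 0]
    with R hR1 hR0
  rw [div_le_iff₀ (sub_pos.mpr hst)] at hR1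
  rw [div_le_iff₀ hR0]
  linarith [hC R hR0.le]

theorem poincareExponent_le (hn : 1 ≤ n) (hr : r ∈ paramSet n) {s : ℝ} (hs : 0 < s)
    (h : poincareSeries G r s ≠ ⊤) : poincareExponent G r ≤ s := by
  refine le_of_forall_gt_imp_ge_of_dense fun t ht => ?_
  refine Filter.limsup_le_of_le ?_ (eventually_log_ncard_div_le hn hr hs h ht)
  refine Filter.IsBoundedUnder.isCoboundedUnder_le ⟨0, ?_⟩
  rw [Filter.eventually_map]
  filter_upwards [Filter.eventually_gt_atTop 0] with R hR
  exact div_nonneg (Real.log_natCast_nonneg _) hR.le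

theorem poincareSeries_ne_top (hn : 1 ≤ n) (hr : r ∈ paramSet n) {s : ℝ} (hs : 0 < s)
    (h : poincareExponent G r < s) : poincareSeries G r s ≠ ⊤ := by
  obtain ⟨t, ht, hts⟩ := exists_between h
  -- A real `limsup` is meaningful only under such a bound. The series converges at `1`, so any
  -- constant above `1` serves.
  have hb : Filter.IsBoundedUnder (· ≤ ·) Filter.atTop
      fun R : ℝ => Real.log ((orbitBall G r R).ncard : ℝ) / R :=
    ⟨2, eventually_log_ncard_div_le hn hr one_pos (poincareSeries_one_ne_top hn hr) one_lt_two⟩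
  have h1 : ∀ᶠ k : ℕ in Filter.atTop,
      Real.log ((orbitBall G r (k : ℝ)).ncard : ℝ) / k < t :=
    tendsto_natCast_atTop_atTop.eventually (Filter.eventually_lt_of_limsup_lt ht hb)
  have h2 : Summable fun k : ℕ => ((orbitBall G r (k : ℝ)).ncard : ℝ) * Real.exp (-s * k) := by
    have h3 : Summable fun k : ℕ => Real.exp (t - s) ^ k :=
      summable_geometric_of_lt_one (Real.exp_pos _).le (Real.exp_lt_one_iff.mpr (by linarith))
    refine Summable.of_norm_bounded_eventually_nat h3 ?_
    filter_upwards [h1, Filter.eventually_gt_atTop 0] with k hk hk0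
    have hk0' : (0 : ℝ) < k := by exact_mod_cast hk0
    rw [div_lt_iff₀ hk0'] at hk
    rw [Real.norm_of_nonneg (by positivity), ← Real.exp_nat_mul]
    have h4 : ((orbitBall G r (k : ℝ)).ncard : ℝ) ≤ Real.exp (t * k) := by
      rcases Nat.eq_zero_or_pos (orbitBall G r (k : ℝ)).ncard with h0 | h0
      · rw [h0, Nat.cast_zero]
        exact (Real.exp_pos _).le
      · exact ((Real.log_lt_iff_lt_exp (by exact_mod_cast h0)).mp hk).le
    refine (mul_le_mul_of_nonneg_right h4 (Real.exp_pos _).le).trans (le_of_eq ?_)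
    rw [← Real.exp_add]
    congr 1
    ring
  -- With `k = ⌈d(1, g)⌉` one has `exp(-s d) ≤ exp(s) exp(-s k)`, and the other terms on the right
  -- are nonnegative. Summing over `g` reduces the series to `∑ₖ N(k) exp(-s k)`, where `N(k)`
  -- counts the ball of radius `k`.
  have h5 : ∀ g : G, ENNReal.ofReal (wordWeight (H r s) g) ≤ ENNReal.ofReal (Real.exp s) *
      ∑' k : ℕ, (orbitBall G r (k : ℝ)).indicator
        (fun _ => ENNReal.ofReal (Real.exp (-s * k))) (g : FreeGroup (Fin n)) := fun g => by
    have hm : (g : FreeGroup (Fin n)) ∈ orbitBall G r (⌈wordLength r g⌉₊ : ℝ) :=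
      ⟨g.2, by rw [pathDist_one_eq hr]; exact Nat.le_ceil _⟩
    have h6 := ENNReal.le_tsum (f := fun k : ℕ => (orbitBall G r (k : ℝ)).indicator
        (fun _ => ENNReal.ofReal (Real.exp (-s * k))) (g : FreeGroup (Fin n))) ⌈wordLength r g⌉₊
    refine le_trans ?_ (mul_le_mul_right h6 _)
    rw [Set.indicator_of_mem hm, ← ENNReal.ofReal_mul (Real.exp_pos _).le, ← Real.exp_add,
      wordWeight_H hr]
    refine ENNReal.ofReal_le_ofReal (Real.exp_le_exp.mpr ?_)
    have := Nat.ceil_lt_add_one (pathLength_nonneg hr (g : FreeGroup (Fin n)).toWord)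
    have h7 : (⌈wordLength r g⌉₊ : ℝ) < wordLength r g + 1 := this
    nlinarith
  refine ((ENNReal.tsum_le_tsum h5).trans_lt ?_).ne
  rw [ENNReal.tsum_mul_left, ENNReal.tsum_comm]
  refine ENNReal.mul_lt_top ENNReal.ofReal_lt_top (lt_of_le_of_lt
    (ENNReal.tsum_le_tsum fun k => ?_) (b := ∑' k : ℕ, ENNReal.ofReal
      (((orbitBall G r (k : ℝ)).ncard : ℝ) * Real.exp (-s * k))) h2.tsum_ofReal_lt_top)
  rw [ENNReal.ofReal_mul (Nat.cast_nonneg _), ENNReal.ofReal_natCast, ← ENat.toENNReal_coe,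
    (finite_orbitBall hn hr _).cast_ncard_eq, ← ENNReal.tsum_set_const,
    tsum_subtype (orbitBall G r k) fun _ => ENNReal.ofReal (Real.exp (-s * k))]
  exact ENNReal.tsum_comp_le_tsum_of_injective Subtype.val_injective
    ((orbitBall G r (k : ℝ)).indicator fun _ => ENNReal.ofReal (Real.exp (-s * k)))

theorem poincareExponent_top_pos (hn : 2 ≤ n) (hr : r ∈ paramSet n) :
    0 < poincareExponent ⊤ r := by
  by_contra! h
  -- As `s ↓ 0` every `u_i` tends to `1`. Once `u_i > 1/3`, each `u_i / (1 + u_i)` exceeds `1/4`,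
  -- and two generators already force `λ ≥ 0`, so the series diverges at this positive `s`.
  obtain ⟨s, hs, hs1⟩ : ∃ s : ℝ, 0 < s ∧ ∀ i, 1 / 3 < H r s i := by
    have h1 : ∀ᶠ s : ℝ in nhdsWithin 0 (Set.Ioi 0), ∀ i, 1 / 3 < H r s i := by
      rw [Filter.eventually_all]
      intro i
      have h2 : Filter.Tendsto (fun s : ℝ => r i ^ s) (nhdsWithin 0 (Set.Ioi 0))
          (nhds (r i ^ (0 : ℝ))) :=
        (Real.continuousAt_const_rpow (hr.1 i).ne').tendsto.mono_left nhdsWithin_le_nhds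
      rw [Real.rpow_zero] at h2
      exact h2.eventually_const_lt (by norm_num)
    obtain ⟨s, hs, hs1⟩ := (h1.and self_mem_nhdsWithin).exists
    exact ⟨s, hs1, hs⟩
  have hu := H_mem hr hs
  have h1 := eigenvalueOf_neg_of_tsum_ne_top (by omega) hu (by
    rw [← poincareSeries_top]
    exact poincareSeries_ne_top (by omega) hr hs (h.trans_lt hs))
  rw [eigenvalueOf_eq (by omega) hu] at h1
  have h2 : ∑ _i : Fin n, (1 / 4 : ℝ) ≤ ∑ i, H r s i / (1 + H r s i) :=
    Finset.sum_le_sum fun i _ => by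
      have := hs1 i
      rw [div_le_div_iff₀ (by norm_num) (by linarith)]
      linarith
  rw [Finset.sum_const, Finset.card_univ, Fintype.card_fin, nsmul_eq_mul] at h2
  have h3 : (2 : ℝ) ≤ n := by exact_mod_cast hn
  have h4 := poleMass_pos (by omega) hu
  nlinarith

end Poincare

/-! ### The transition operator -/

section Operator

variable {n : ℕ} (G : Subgroup (FreeGroup (Fin n)))

theorem transition_apply_eq_sum (p : Fin n → ℝ) (f : L2 G) (v : Vertex G) :
    transition G p f v = ∑ a : Fin n × Bool, (p a.1 : ℂ) * f (vertexStep G a v) := by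
  rw [transition_apply, Fintype.sum_prod_type]
  refine Finset.sum_congr rfl fun i _ => ?_
  rw [Fintype.sum_bool, mul_add]
  rfl

theorem tsum_enorm_sq {V : Type} (f : lp (fun _ : V => ℂ) 2) :
    ∑' v, ‖f v‖ₑ ^ 2 = ENNReal.ofReal (‖f‖ ^ 2) := by
  have h := lp.hasSum_norm (p := 2) (by norm_num) f
  simp only [ENNReal.toReal_ofNat, Real.rpow_two] at h
  rw [← h.tsum_eq, ENNReal.ofReal_tsum_of_nonneg (fun _ => sq_nonneg _) h.summable]
  refine tsum_congr fun v => ?_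
  rw [ENNReal.ofReal_pow (norm_nonneg _), ofReal_norm]

theorem exists_lp_of_tsum_sq_ne_top {V : Type} {f : V → ℝ≥0∞} (hf : ∑' v, f v ^ 2 ≠ ⊤) :
    ∃ g : lp (fun _ : V => ℂ) 2, ∀ v, g v = ((f v).toReal : ℂ) := by
  have h : Memℓp (fun v => ((f v).toReal : ℂ)) 2 := by
    rw [memℓp_gen_iff (by norm_num)]
    refine (ENNReal.summable_toReal hf).congr fun v => ?_
    simp
  exact ⟨⟨_, h⟩, fun _ => rfl⟩

/-- Nonnegative weights give `|A f| ≤ A |f|`, so the norm is determined by nonnegative functions. -/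
theorem norm_transition_le_iff {p : Fin n → ℝ} (hp : ∀ i, 0 ≤ p i) {M : ℝ} (hM : 0 < M) :
    ‖transition G p‖ ≤ M ↔
      L2Bound (vertexStep G) (fun i => ENNReal.ofReal (p i)) (ENNReal.ofReal M) := by
  constructor
  · intro h f
    by_cases hf : ∑' v, f v ^ 2 = ⊤
    · rw [hf, ENNReal.mul_top (pow_ne_zero 2 (ENNReal.ofReal_pos.mpr hM).ne')]
      exact le_top
    have hf' : ∀ v, f v ≠ ⊤ := fun v hv => ENNReal.ne_top_of_tsum_ne_top hf v (by simp [hv])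
    obtain ⟨g, hg⟩ := exists_lp_of_tsum_sq_ne_top hf
    have h1 : ∀ v, f v = ‖g v‖ₑ := fun v => by
      rw [hg, ← ofReal_norm, Complex.norm_real, Real.norm_of_nonneg ENNReal.toReal_nonneg,
        ENNReal.ofReal_toReal (hf' v)]
    have h2 : ∀ v, letterSum (vertexStep G) (fun i => ENNReal.ofReal (p i)) f v =
        ‖transition G p g v‖ₑ := fun v => by
      rw [transition_apply_eq_sum]
      simp only [hg, ← Complex.ofReal_mul, ← Complex.ofReal_sum]
      rw [← ofReal_norm, Complex.norm_real, Real.norm_of_nonneg (Finset.sum_nonneg fun a _ =>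
        mul_nonneg (hp _) ENNReal.toReal_nonneg), ENNReal.ofReal_sum_of_nonneg fun a _ =>
        mul_nonneg (hp _) ENNReal.toReal_nonneg]
      refine Finset.sum_congr rfl fun a _ => ?_
      rw [ENNReal.ofReal_mul (hp _), ENNReal.ofReal_toReal (hf' _)]
    simp only [h2]
    rw [show ∑' v, f v ^ 2 = ∑' v, ‖g v‖ₑ ^ 2 from tsum_congr fun v => by rw [h1]]
    rw [tsum_enorm_sq, tsum_enorm_sq, ← ENNReal.ofReal_pow hM.le,
      ← ENNReal.ofReal_mul (sq_nonneg _), ← mul_pow]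
    exact ENNReal.ofReal_le_ofReal (pow_le_pow_left₀ (norm_nonneg _)
      ((transition G p).le_of_opNorm_le h g) 2)
  · intro h
    refine ContinuousLinearMap.opNorm_le_bound _ hM.le fun g => ?_
    have h1 := h fun v => ‖g v‖ₑ
    rw [tsum_enorm_sq, ← ENNReal.ofReal_pow hM.le, ← ENNReal.ofReal_mul (sq_nonneg _),
      ← mul_pow] at h1
    have h2 : ∑' v, ‖transition G p g v‖ₑ ^ 2 ≤ ENNReal.ofReal ((M * ‖g‖) ^ 2) := by
      refine (ENNReal.tsum_le_tsum fun v => ?_).trans h1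
      refine pow_le_pow_left₀ zero_le ?_ 2
      rw [transition_apply_eq_sum]
      refine (enorm_sum_le _ _).trans (Finset.sum_le_sum fun a _ => ?_)
      rw [enorm_mul, ← ofReal_norm (p a.1 : ℂ), Complex.norm_real, Real.norm_of_nonneg (hp _)]
    rw [tsum_enorm_sq, ENNReal.ofReal_le_ofReal_iff (by positivity)] at h2
    exact (pow_le_pow_iff_left₀ (norm_nonneg _) (by positivity) two_ne_zero).mp h2

theorem adjoint_compPerm {V : Type} (σ : V ≃ V) :
    ContinuousLinearMap.adjoint (compPerm σ) = compPerm σ.symm := by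
  symm
  rw [ContinuousLinearMap.eq_adjoint_iff]
  intro f g
  rw [lp.inner_eq_tsum, lp.inner_eq_tsum, ← σ.tsum_eq]
  refine tsum_congr fun v => ?_
  change inner ℂ (f (σ.symm (σ v))) (g (σ v)) = inner ℂ (f v) (g (σ v))
  rw [Equiv.symm_apply_apply]

theorem isSelfAdjoint_transition (p : Fin n → ℝ) : IsSelfAdjoint (transition G p) := by
  have h : ∀ g, star (compPerm (rightMul G g)) = compPerm (rightMul G g⁻¹) := fun g => by
    rw [ContinuousLinearMap.star_eq_adjoint, adjoint_compPerm, rightMul_inv]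
  rw [IsSelfAdjoint, transition, star_sum]
  refine Finset.sum_congr rfl fun i _ => ?_
  rw [star_smul, star_add, h, h, inv_inv, add_comm]
  congr 1
  exact Complex.conj_ofReal _

/-! ### The norm as a point of the spectrum -/

theorem memLp_norm {V : Type} (f : lp (fun _ : V => ℂ) 2) :
    Memℓp (fun v => (‖f v‖ : ℂ)) 2 := by
  have h : 0 < (2 : ℝ≥0∞).toReal := by norm_num
  rw [memℓp_gen_iff h]
  simpa using (lp.memℓp f).summable h

/-- The absolute value of a square-summable function. -/
def absLp {V : Type} (f : lp (fun _ : V => ℂ) 2) : lp (fun _ : V => ℂ) 2 :=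
  ⟨fun v => (‖f v‖ : ℂ), memLp_norm f⟩

theorem absLp_apply {V : Type} (f : lp (fun _ : V => ℂ) 2) (v : V) : absLp f v = (‖f v‖ : ℂ) := rfl

theorem norm_absLp {V : Type} (f : lp (fun _ : V => ℂ) 2) : ‖absLp f‖ = ‖f‖ := by
  rw [lp.norm_eq_tsum_rpow (by norm_num), lp.norm_eq_tsum_rpow (by norm_num)]
  simp [absLp_apply]

theorem abs_rayleighQuotient_transition_le {p : Fin n → ℝ} (hp : ∀ i, 0 ≤ p i) (f : L2 G) :
    |(transition G p).rayleighQuotient f| ≤ (transition G p).rayleighQuotient (absLp f) := by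
  rw [ContinuousLinearMap.rayleighQuotient, ContinuousLinearMap.rayleighQuotient, norm_absLp,
    abs_div, abs_of_nonneg (sq_nonneg ‖f‖)]
  refine div_le_div_of_nonneg_right ?_ (sq_nonneg _)
  rw [ContinuousLinearMap.reApplyInnerSelf_apply, ContinuousLinearMap.reApplyInnerSelf_apply]
  refine (RCLike.abs_re_le_norm _).trans ?_
  have hs := lp.summable_inner (𝕜 := ℂ) (transition G p (absLp f)) (absLp f)
  have hre : ∀ v, inner ℂ (transition G p (absLp f) v) (absLp f v) =
      ((‖f v‖ * ∑ a : Fin n × Bool, p a.1 * ‖f (vertexStep G a v)‖ : ℝ) : ℂ) := fun v => by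
    rw [transition_apply_eq_sum]
    simp only [absLp_apply, ← Complex.ofReal_mul, ← Complex.ofReal_sum]
    rw [RCLike.inner_apply, Complex.conj_ofReal, ← Complex.ofReal_mul]
  rw [lp.inner_eq_tsum, lp.inner_eq_tsum]
  simp only [hre] at hs ⊢
  rw [← Complex.ofReal_tsum]
  rw [Complex.summable_ofReal] at hs
  refine tsum_of_norm_bounded hs.hasSum fun v => ?_
  refine (norm_inner_le_norm _ _).trans ?_
  rw [mul_comm]
  refine mul_le_mul_of_nonneg_left ?_ (norm_nonneg _)
  rw [transition_apply_eq_sum]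
  refine (norm_sum_le _ _).trans (Finset.sum_le_sum fun a _ => ?_)
  rw [norm_mul, Complex.norm_real, Real.norm_of_nonneg (hp _)]

/-- Were the norm in the resolvent set, Rayleigh quotients would stay below `‖A‖ - ε`. Replacing `f`
by `|f|` bounds their absolute values too, contradicting that the norm of a self-adjoint operator is
the supremum of these. -/
theorem norm_transition_mem_spectrum {p : Fin n → ℝ} (hp : ∀ i, 0 ≤ p i) :
    (‖transition G p‖ : ℂ) ∈ spectrum ℂ (transition G p) := by
  by_contra h
  have : Nontrivial (L2 G) := by
    classical
    refine ⟨lp.single 2 (coset G 1) 1, 0, fun h => ?_⟩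
    have := congrArg (fun f : L2 G => f (coset G 1)) h
    simp at this
  obtain ⟨ε, hε, h1⟩ := (transition G p).rayleighQuotient_le_of_norm_mem_resolventSet
    (by simpa [spectrum] using h)
  have h2 := (transition G p).norm_eq_iSup_rayleighQuotient
    (isSelfAdjoint_transition G p).isSymmetric
  have h3 : ⨆ f, |(transition G p).rayleighQuotient f| ≤ ‖transition G p‖ - ε :=
    ciSup_le fun f => (abs_rayleighQuotient_transition_le G hp f).trans (h1 _)
  linarith

theorem isBottomOfSpectrum_laplacian {p : Fin n → ℝ} (hp : ∀ i, 0 ≤ p i) :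
    IsBottomOfSpectrum (laplacian G p) (1 - ‖transition G p‖) := by
  have h : ∀ z : ℂ, z ∈ spectrum ℂ (laplacian G p) ↔ 1 - z ∈ spectrum ℂ (transition G p) := by
    intro z
    have h1 := spectrum.singleton_sub_eq (transition G p) (1 : ℂ)
    rw [map_one] at h1
    rw [laplacian, ← h1, Set.singleton_sub]
    constructor
    · rintro ⟨w, hw, rfl⟩
      simpa using hw
    · exact fun hz => ⟨1 - z, hz, by simp⟩
  constructor
  · rw [Set.mem_ofPred_eq, h]
    simpa using norm_transition_mem_spectrum G hp
  · intro t ht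
    rw [Set.mem_ofPred_eq, h, ← Complex.ofReal_one, ← Complex.ofReal_sub] at ht
    have h2 := spectrum.norm_le_norm_mul_of_mem ht
    rw [Complex.norm_real, Real.norm_eq_abs] at h2
    have h3 : ‖transition G p‖ * ‖(1 : L2 G →L[ℂ] L2 G)‖ ≤ ‖transition G p‖ :=
      mul_le_of_le_one_right (norm_nonneg _) ContinuousLinearMap.norm_id_le
    linarith [le_abs_self (1 - t)]

end Operator

/-! ### The norm of the transition operator along the curve `s ↦ H r s` -/

section Cogrowth

variable {n : ℕ} (G : Subgroup (FreeGroup (Fin n))) {r : Fin n → ℝ}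

theorem transition_div (p : Fin n → ℝ) (c : ℝ) :
    transition G (fun i => p i / c) = (c : ℂ)⁻¹ • transition G p := by
  simp only [transition, Finset.smul_sum, smul_smul]
  refine Finset.sum_congr rfl fun i _ => ?_
  congr 1
  push_cast
  ring

theorem l2Bound_normWeight_iff (hn : 1 ≤ n) {u : Fin n → ℝ} (hu : ∀ i, 0 < u i ∧ u i < 1)
    {κ : ℝ} (hκ : 0 < κ) : L2Bound (vertexStep G) (normWeight u) (ENNReal.ofReal κ) ↔
      ‖transition G (weightOf u)‖ ≤ κ * (1 - eigenvalueOf u) := by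
  have hμ := one_sub_eigenvalueOf_pos hn hu
  have h := norm_transition_le_iff G (p := fun i => weightOf u i / (1 - eigenvalueOf u))
    (fun i => (div_pos ((weightOf_spec hn u hu).1.1 i) hμ).le) hκ
  rw [transition_div, norm_smul, norm_inv, Complex.norm_real, Real.norm_of_nonneg hμ.le,
    inv_mul_le_iff₀ hμ, mul_comm (1 - eigenvalueOf u)] at h
  exact h.symm

/-- The fibre sum of the Green function is a supersolution. Convergence at the trivial coset makes
it finite everywhere by connectedness, and Schur's test applies. -/
theorem norm_transition_le_of_poincareSeries_ne_top (hn : 1 ≤ n) (hr : r ∈ paramSet n) {s : ℝ}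
    (hs : 0 < s) (h : poincareSeries G r s ≠ ⊤) :
    ‖transition G (weightOf (H r s))‖ ≤ 1 - eigenvalueOf (H r s) := by
  have hu := H_mem hr hs
  have hg := (isGreen_wordWeight hn hu).fibreSum (coset_letterPerm G)
  have hsup : ∀ v, letterSum (vertexStep G) (normWeight (H r s)) (fibreSum (coset G)
      fun x => ENNReal.ofReal (wordWeight (H r s) x)) v ≤ 1 * fibreSum (coset G)
      (fun x => ENNReal.ofReal (wordWeight (H r s) x)) v := fun v => by
    rw [one_mul, hg v]
    exact le_self_add
  have h1 : L2Bound (vertexStep G) (normWeight (H r s)) (ENNReal.ofReal 1) := by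
    rw [ENNReal.ofReal_one]
    refine L2Bound.of_supersolution (isInverseClosed_vertexStep G) (normWeight_ne_top _) one_ne_zero
      (supersolution_ne_top (isConnectedFrom_vertexStep G) (normWeight_ne_zero hn hu)
        ENNReal.one_ne_top hsup (by rwa [fibreSum_coset_one])) (fun v => ?_) hsup
    obtain ⟨x, rfl⟩ : ∃ x, coset G x = v := Quotient.exists_rep v
    exact ((ENNReal.ofReal_pos.mpr (wordWeight_pos (fun i => (hu i).1) x)).trans_le
      (le_fibreSum (fun x => ENNReal.ofReal (wordWeight (H r s) x)) x)).ne'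
  rwa [l2Bound_normWeight_iff G hn hu one_pos, one_mul] at h1

/-- This doubling is the origin of the threshold `δ/2`: `w` is square-summable when `2s > δ`. -/
theorem tsum_wordWeight_sq (hr : r ∈ paramSet n) (s : ℝ) :
    ∑' x, ENNReal.ofReal (wordWeight (H r s) x) ^ 2 = poincareSeries ⊤ r (2 * s) := by
  rw [poincareSeries_top]
  refine tsum_congr fun x => ?_
  have h : 0 ≤ wordWeight (H r s) x :=
    (wordWeight_pos (fun i => Real.rpow_pos_of_pos (hr.1 i) s) x).le
  rw [← wordWeight_H_sq hr, ENNReal.ofReal_pow h]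

theorem l2Bound_letterPerm (hn : 1 ≤ n) (hr : r ∈ paramSet n) {s κ κ' : ℝ} (hs : 0 < s)
    (hκ : 0 < κ) (hκ' : κ < κ')
    (h : ‖transition G (weightOf (H r s))‖ ≤ κ * (1 - eigenvalueOf (H r s))) :
    L2Bound letterPerm (normWeight (H r s)) (ENNReal.ofReal κ') := by
  have hu := H_mem hr hs
  exact ((l2Bound_normWeight_iff G hn hu hκ).mpr h).of_covering (coset_letterPerm G)
    isInverseClosed_letterPerm (isInverseClosed_vertexStep G) (isConnectedFrom_vertexStep G)
    (normWeight_ne_zero hn hu) (normWeight_ne_top _)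
    ((ENNReal.ofReal_lt_ofReal_iff (hκ.trans hκ')).mpr hκ') ENNReal.ofReal_ne_top

/-- Two factors are provided because passing to the covering loses an arbitrarily small amount of
the norm bound. -/
theorem exists_contraction_factor {a b : ℝ} (ha : 0 ≤ a) (hab : a < b) :
    ∃ κ κ' : ℝ, 0 < κ ∧ κ < κ' ∧ κ' < 1 ∧ a < κ * b := by
  have hb := ha.trans_lt hab
  obtain ⟨κ, h1, h2⟩ := exists_between ((div_lt_one hb).mpr hab)
  obtain ⟨κ', h3, h4⟩ := exists_between h2
  exact ⟨κ, κ', (div_nonneg ha hb.le).trans_lt h1, h3, h4, (div_lt_iff₀ hb).mp h1⟩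

/-- Square-summability of `w` makes its iterates upstairs vanish in the limit; the strict norm bound
downstairs then sums the pushed-down Neumann series. -/
theorem poincareSeries_ne_top_of_norm_transition_lt (hn : 1 ≤ n) (hr : r ∈ paramSet n) {s : ℝ}
    (hs : 0 < s) (h2 : poincareSeries ⊤ r (2 * s) ≠ ⊤)
    (h : ‖transition G (weightOf (H r s))‖ < 1 - eigenvalueOf (H r s)) :
    poincareSeries G r s ≠ ⊤ := by
  have hu := H_mem hr hs
  obtain ⟨κ, κ', hκ, hκκ, hκ1, hlt⟩ := exists_contraction_factor (norm_nonneg _) h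
  have hF := l2Bound_letterPerm G hn hr hs hκ hκκ hlt.le
  have h3 := (isGreen_wordWeight hn hu).fibreSum_lt_top ENNReal.ofReal_ne_top (coset_letterPerm G)
    (hF.tendsto_iterate (ENNReal.ofReal_lt_one.mpr hκ1) (by rwa [tsum_wordWeight_sq hr]))
    (ENNReal.ofReal_lt_one.mpr (hκκ.trans hκ1))
    ((l2Bound_normWeight_iff G hn hu hκ).mpr hlt.le) (coset G 1)
  rw [fibreSum_coset_one] at h3
  exact h3.ne

/-- The point is uniformity: the bound depends only on `κ'`, not on `s`. -/
theorem poincareSeries_two_mul_le (hn : 1 ≤ n) (hr : r ∈ paramSet n) {s κ κ' : ℝ}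
    (hs : 0 < s) (h2 : poincareSeries ⊤ r (2 * s) ≠ ⊤) (hκ : 0 < κ) (hκκ : κ < κ') (hκ1 : κ' < 1)
    (h : ‖transition G (weightOf (H r s))‖ ≤ κ * (1 - eigenvalueOf (H r s))) :
    poincareSeries ⊤ r (2 * s) ≤ 1 / (1 - ENNReal.ofReal κ') := by
  have hu := H_mem hr hs
  have hF := l2Bound_letterPerm G hn hr hs hκ hκκ h
  rw [← tsum_wordWeight_sq hr] at h2 ⊢
  refine ((isGreen_wordWeight hn hu).tsum_sq_le h2
    (ENNReal.ofReal_pos.mpr (hκ.trans hκκ)).ne' (ENNReal.ofReal_lt_one.mpr hκ1) hF).trans ?_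
  refine ENNReal.div_le_div_right ?_ _
  rw [wordWeight_one, ENNReal.ofReal_one, mul_one, ENNReal.ofReal_le_one,
    div_le_one (one_sub_eigenvalueOf_pos hn hu)]
  exact (poleMass_lt hn hu).le

/-! ### Continuity in `s` -/

theorem continuous_H (hr : r ∈ paramSet n) (i : Fin n) : Continuous fun s => H r s i :=
  Real.continuous_const_rpow (hr.1 i).ne'

theorem detD_pos (hn : 1 ≤ n) {u : Fin n → ℝ} (hu : ∀ i, 0 < u i ∧ u i < 1) : 0 < detD u := by
  have : Nonempty (Fin n) := ⟨⟨0, hn⟩⟩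
  exact Finset.sum_pos (fun j _ => Finset.prod_pos fun k _ =>
    sub_pos.mpr ((hu k).2.trans (one_lt_inv₀ (hu k).1 |>.mpr (hu k).2))) Finset.univ_nonempty

theorem continuousAt_inv_sub_H (hr : r ∈ paramSet n) (s : ℝ) (i : Fin n) :
    ContinuousAt (fun s => (H r s i)⁻¹ - H r s i) s :=
  ((continuous_H hr i).continuousAt.inv₀ (Real.rpow_pos_of_pos (hr.1 i) s).ne').sub
    (continuous_H hr i).continuousAt

theorem continuousAt_prod_H (hr : r ∈ paramSet n) (s : ℝ) (t : Finset (Fin n)) :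
    ContinuousAt (fun s => ∏ k ∈ t, ((H r s k)⁻¹ - H r s k)) s :=
  tendsto_finsetProd _ fun i _ => continuousAt_inv_sub_H hr s i

theorem continuousAt_detD_H (hr : r ∈ paramSet n) (s : ℝ) :
    ContinuousAt (fun s => detD (H r s)) s :=
  tendsto_finsetSum _ fun _ _ => continuousAt_prod_H hr s _

theorem continuousAt_weightOf_H (hn : 1 ≤ n) (hr : r ∈ paramSet n) {s : ℝ} (hs : 0 < s)
    (i : Fin n) : ContinuousAt (fun s => weightOf (H r s) i) s :=
  (continuousAt_prod_H hr s _).div (continuousAt_const.mul (continuousAt_detD_H hr s))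
    (mul_pos two_pos (detD_pos hn (H_mem hr hs))).ne'

theorem continuousAt_eigenvalueOf_H (hn : 1 ≤ n) (hr : r ∈ paramSet n) {s : ℝ} (hs : 0 < s) :
    ContinuousAt (fun s => eigenvalueOf (H r s)) s :=
  ((continuousAt_detD_H hr s).inv₀ (detD_pos hn (H_mem hr hs)).ne').mul
    (ContinuousAt.sub (tendsto_finsetSum _ fun i _ =>
      (continuousAt_const.sub (continuous_H hr i).continuousAt).mul (continuousAt_prod_H hr s _))
      (continuousAt_const.mul (continuousAt_prod_H hr s _)))

theorem continuousAt_norm_transition_H (hn : 1 ≤ n) (hr : r ∈ paramSet n) {s : ℝ} (hs : 0 < s) :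
    ContinuousAt (fun s => ‖transition G (weightOf (H r s))‖) s :=
  ContinuousAt.norm (tendsto_finsetSum _ fun i _ =>
    (Complex.continuous_ofReal.continuousAt.comp (continuousAt_weightOf_H hn hr hs i)).smul
      continuousAt_const)

theorem continuous_wordWeight_H (hr : r ∈ paramSet n) (x : FreeGroup (Fin n)) :
    Continuous fun s => wordWeight (H r s) x := by
  simp only [wordWeight_H hr]
  fun_prop

/-- Convergence may fail at `s = δ_G` itself, so the inequality is obtained as a limit from the
right. -/
theorem norm_transition_le (hn : 1 ≤ n) (hr : r ∈ paramSet n) {s : ℝ} (hs : 0 < s)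
    (h : poincareExponent G r ≤ s) :
    ‖transition G (weightOf (H r s))‖ ≤ 1 - eigenvalueOf (H r s) := by
  refine le_of_tendsto_of_tendsto
    ((continuousAt_norm_transition_H G hn hr hs).tendsto.mono_left nhdsWithin_le_nhds)
    ((continuousAt_const.sub (continuousAt_eigenvalueOf_H hn hr hs)).tendsto.mono_left
      nhdsWithin_le_nhds) (b := nhdsWithin s (Set.Ioi s)) ?_
  filter_upwards [self_mem_nhdsWithin] with t ht
  have ht' : s < t := ht
  exact norm_transition_le_of_poincareSeries_ne_top G hn hr (hs.trans ht')
    (poincareSeries_ne_top hn hr (hs.trans ht') (h.trans_lt ht'))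

/-- The Poincaré series of the free group diverges at its exponent. -/
theorem poincareSeries_poincareExponent_top (hn : 2 ≤ n) (hr : r ∈ paramSet n) :
    poincareSeries ⊤ r (poincareExponent ⊤ r) = ⊤ := by
  by_contra h
  have hn1 : 1 ≤ n := by omega
  have hδ := poincareExponent_top_pos hn hr
  rw [poincareSeries_top] at h
  -- Convergence at `δ` would mean `λ < 0` there, hence also slightly to the left, where the series
  -- would then converge below its own exponent.
  have h1 := (continuousAt_eigenvalueOf_H hn1 hr hδ).tendsto.eventually_lt_const
    (eigenvalueOf_neg_of_tsum_ne_top hn1 (H_mem hr hδ) h)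
  have h2 := (h1.and (lt_mem_nhds hδ)).filter_mono
    (nhdsWithin_le_nhds (s := Set.Iio (poincareExponent ⊤ r)))
  obtain ⟨s, ⟨h3, h4⟩, h5⟩ := (h2.and self_mem_nhdsWithin).exists
  refine (poincareExponent_le hn1 hr h4 ?_).not_gt h5
  rw [poincareSeries_top]
  exact tsum_ne_top_of_eigenvalueOf_neg hn1 (H_mem hr h4) h3

theorem norm_transition_eq_of_half_lt (hn : 2 ≤ n) (hr : r ∈ paramSet n)
    (h : poincareExponent ⊤ r / 2 < poincareExponent G r) :
    ‖transition G (weightOf (H r (poincareExponent G r)))‖ =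
      1 - eigenvalueOf (H r (poincareExponent G r)) := by
  have hn1 : 1 ≤ n := by omega
  have hδ := poincareExponent_top_pos hn hr
  have hs : 0 < poincareExponent G r := by linarith
  refine le_antisymm (norm_transition_le G hn1 hr hs le_rfl) ?_
  by_contra! hlt
  -- The strict inequality persists at some `s` with `δ/2 < s < δ_G`; there the Poincaré series of
  -- `G` converges, contradicting `s < δ_G`.
  have h1 := (continuousAt_norm_transition_H G hn1 hr hs).tendsto.eventually_lt
    (continuousAt_const.sub (continuousAt_eigenvalueOf_H hn1 hr hs)).tendsto hlt
  have h2 := (h1.and (lt_mem_nhds h)).filter_mono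
    (nhdsWithin_le_nhds (s := Set.Iio (poincareExponent G r)))
  obtain ⟨s, ⟨h3, h4⟩, h5⟩ := (h2.and self_mem_nhdsWithin).exists
  have hs' : 0 < s := by linarith
  exact (poincareExponent_le hn1 hr hs' (poincareSeries_ne_top_of_norm_transition_lt G hn1 hr hs'
    (poincareSeries_ne_top hn1 hr (by linarith) (by linarith)) h3)).not_gt h5

theorem norm_transition_eq_of_le_half (hn : 2 ≤ n) (hr : r ∈ paramSet n)
    (h : poincareExponent G r ≤ poincareExponent ⊤ r / 2) :
    ‖transition G (weightOf (H r (poincareExponent ⊤ r / 2)))‖ =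
      1 - eigenvalueOf (H r (poincareExponent ⊤ r / 2)) := by
  have hn1 : 1 ≤ n := by omega
  have hδ := poincareExponent_top_pos hn hr
  have hs : 0 < poincareExponent ⊤ r / 2 := by linarith
  refine le_antisymm (norm_transition_le G hn1 hr hs h) ?_
  by_contra! hlt
  obtain ⟨κ, κ', hκ, hκκ, hκ1, hlt'⟩ := exists_contraction_factor (norm_nonneg _) hlt
  have h1 := ((continuousAt_norm_transition_H G hn1 hr hs).tendsto.eventually_lt
    (continuousAt_const.mul (continuousAt_const.sub
      (continuousAt_eigenvalueOf_H hn1 hr hs))).tendsto hlt').filter_mono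
    (nhdsWithin_le_nhds (s := Set.Ioi (poincareExponent ⊤ r / 2)))
  -- Finite partial sums are continuous in `s`, so the uniform bound for `s > δ/2` passes to the
  -- limit `s = δ/2`. The resulting finite sum is the series of `F_n` at `δ`, which diverges.
  have h2 : ∑' x, ENNReal.ofReal (wordWeight (H r (2 * (poincareExponent ⊤ r / 2))) x) ≤
      1 / (1 - ENNReal.ofReal κ') := by
    refine ENNReal.summable.tsum_le_of_sum_le fun T => ?_
    have h3 : Continuous fun s => ∑ x ∈ T, ENNReal.ofReal (wordWeight (H r (2 * s)) x) :=
      continuous_finsetSum _ fun x _ => ENNReal.continuous_ofReal.comp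
        ((continuous_wordWeight_H hr x).comp (continuous_const.mul continuous_id))
    refine le_of_tendsto (h3.continuousAt.tendsto.mono_left (nhdsWithin_le_nhds
      (s := Set.Ioi (poincareExponent ⊤ r / 2)))) ?_
    filter_upwards [h1, self_mem_nhdsWithin] with s h4 h5
    have h5' : poincareExponent ⊤ r / 2 < s := h5
    have hs' : 0 < s := hs.trans h5'
    refine (ENNReal.sum_le_tsum T).trans ?_
    rw [← poincareSeries_top]
    exact poincareSeries_two_mul_le G hn1 hr hs' (poincareSeries_ne_top hn1 hr (by linarith)
      (by linarith)) hκ hκκ hκ1 h4.le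
  rw [mul_div_cancel₀ _ two_ne_zero, ← poincareSeries_top,
    poincareSeries_poincareExponent_top hn hr, top_le_iff] at h2
  exact ENNReal.div_ne_top ENNReal.one_ne_top
    (tsub_pos_iff_lt.mpr (ENNReal.ofReal_lt_one.mpr hκ1)).ne' h2

theorem isBottomOfSpectrum_eigenvalueOf (hn : 1 ≤ n) {u : Fin n → ℝ}
    (hu : ∀ i, 0 < u i ∧ u i < 1) (h : ‖transition G (weightOf u)‖ = 1 - eigenvalueOf u) :
    IsBottomOfSpectrum (laplacian G (weightOf u)) (eigenvalueOf u) := by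
  have h1 := isBottomOfSpectrum_laplacian G fun i => ((weightOf_spec hn u hu).1.1 i).le
  rwa [h, sub_sub_cancel] at h1

end Cogrowth

end WeightedCogrowth

end

theorem theorem3 (n : ℕ) (hn : 2 ≤ n) (G : Subgroup (FreeGroup (Fin n))) (r : Fin n → ℝ)
    (hr : r ∈ WeightedCogrowth.paramSet n) :
    (WeightedCogrowth.poincareExponent ⊤ r / 2 < WeightedCogrowth.poincareExponent G r →
      WeightedCogrowth.IsBottomOfSpectrum
        (WeightedCogrowth.laplacian G
          (WeightedCogrowth.pStar r (WeightedCogrowth.poincareExponent G r)))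
        (WeightedCogrowth.eigenvalueOf
          (WeightedCogrowth.H r (WeightedCogrowth.poincareExponent G r)))) ∧
    (WeightedCogrowth.poincareExponent G r ≤ WeightedCogrowth.poincareExponent ⊤ r / 2 →
      WeightedCogrowth.IsBottomOfSpectrum
        (WeightedCogrowth.laplacian G
          (WeightedCogrowth.pStar r (WeightedCogrowth.poincareExponent G r)))
        (WeightedCogrowth.eigenvalueOf
          (WeightedCogrowth.H r (WeightedCogrowth.poincareExponent ⊤ r / 2)))) := by
  have hδ := WeightedCogrowth.poincareExponent_top_pos hn hr
  refine ⟨fun h => ?_, fun h => ?_⟩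
  · rw [WeightedCogrowth.pStar, if_pos h]
    exact WeightedCogrowth.isBottomOfSpectrum_eigenvalueOf G (by omega)
      (WeightedCogrowth.H_mem hr (by linarith))
      (WeightedCogrowth.norm_transition_eq_of_half_lt G hn hr h)
  · rw [WeightedCogrowth.pStar, if_neg h.not_gt]
    exact WeightedCogrowth.isBottomOfSpectrum_eigenvalueOf G (by omega)
      (WeightedCogrowth.H_mem hr (by linarith))
      (WeightedCogrowth.norm_transition_eq_of_le_half G hn hr h)
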